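/- Let $M$ be a connected compact topological manifold, possibly with boundary, with a compatible metric, let $\varphi$ be a continuous flow on $M$, and fix $T>0$. Let $\alpha\in H^1(M,\mathbb R)$. Let $\widehat M\to M$ be the universal Abelian covering (with deck group $H_1(M,\mathbb Z)$), and $\widehat M_\alpha=\widehat M/\ker_{\mathbb Z}(\alpha)$, where $\ker_{\mathbb Z}(\alpha)=\{\delta\in H_1(M,\mathbb Z):\alpha(\delta)=0\}$. Each is equipped with the lifted flow and with any compatible metric that is invariant under deck transformations and for which the covering map restricts to an isometry onto its image on all sufficiently small balls. An $(\epsilon,T)$-pseudo-orbit of length $l>0$ is a right-continuous curve $\gamma$ on $[0,l[$ that is continuous outside a finite set $\Delta$ disjoint from $[0,T[$ whose points are at distance at least $T$ from each other, that follows the flow on every interval on which it is continuous, and for which $\gamma(u)$ and $\gamma(u^-)=\lim_{s\to u^-}\gamma(s)$ are at distance less than $\epsilon$ for every $u\in\Delta$. A periodic $(\epsilon,T)$-pseudo-orbit of length $\mathrm{len}(\gamma)=l$ is similarly a curve $\gamma\colon\mathbb R/l\mathbb Z\to M$, consecutive discontinuities (of its $l$-periodic lift to $\mathbb R$) being at distance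 at least $T$. Its class $[\gamma]\in H_1(M,\mathbb R)$ is the class of an $\epsilon$-realization, that is, of a closed curve obtained by inserting in $\gamma$, at each discontinuity $u$, a continuous curve from $\gamma(u^-)$ to $\gamma(u)$ inside the $\epsilon$-ball centred at $\gamma(u)$. Call $\epsilon>0$ small if any two curves with the same ends that lie in a common $\epsilon$-ball are homotopic in $M$ relative to their ends (so that $[\gamma]$ does not depend on the realization), and let $$D_{\varphi,\epsilon,T}=\overline{\left\{\tfrac1{\mathrm{len}(\gamma)}[\gamma] : \gamma\text{ a periodic }(\epsilon,T)\text{-pseudo-orbit in }M\right\}}\subset H_1(M,\mathbb R).$$ A continuous function $f$ on $\widehat M_\alpha$ (or $\widehat M$) is $\alpha$-equivariant if $f(\delta\cdot x)=\alpha(\delta)+f(x)$ for all $x$ and all $\delta\in H_1(M,\mathbb Z)$. It is quasi-Lyapunov if there are $C\ge 0$ and $\epsilon>0$ such that $f(\gamma(0))\ge f(\gamma(t))-C$ for every $(\epsilon,T)$-pseudo-orbit $\gamma$ of the lifted flow and every $t\in[0,\mathrm{len}(\gamma)[$. The class $\alpha$ is quasi-Lyapunov if every continuous $\alpha$-equivariant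 function is quasi-Lyapunov. Then the following conditions are equivalent: 1. $\alpha$ is quasi-Lyapunov, with functions on $\widehat M_\alpha$; 2. $\alpha$ is quasi-Lyapunov, with functions on $\widehat M$; 3. $\alpha(D_{\varphi,\epsilon,T})\le 0$ for some small $\epsilon>0$; 4. there is $\epsilon_0>0$ such that every $\epsilon\in{]0,\epsilon_0[}$ is small and satisfies $\alpha(D_{\varphi,\epsilon,T})\le 0$; 5. for some small $\epsilon>0$, every periodic $(\epsilon,T)$-pseudo-orbit $\gamma$ in $M$ satisfies $\alpha([\gamma])\le 0$; 6. there is $\epsilon_0>0$ such that every $\epsilon\in{]0,\epsilon_0[}$ is small and every periodic $(\epsilon,T)$-pseudo-orbit $\gamma$ in $M$ satisfies $\alpha([\gamma])\le 0$. -/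

import Mathlib

open Set Filter Topology

noncomputable section

namespace QuasiLyapunov

/-! ### Singular homology and cohomology in degree one -/

/-- Singular `n`-simplices of `X`. -/
abbrev Simplex (n : ℕ) (X : Type*) [TopologicalSpace X] : Type _ :=
  C(stdSimplex ℝ (Fin (n + 1)), X)

/-- The inclusion of the `i`-th face (the one opposite to the vertex `i`) of the standard
simplex. -/
def faceMap (n : ℕ) (i : Fin (n + 2)) :
    C(stdSimplex ℝ (Fin (n + 1)), stdSimplex ℝ (Fin (n + 2))) :=
  ⟨stdSimplex.map i.succAbove, stdSimplex.continuous_map _⟩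

variable (R : Type) [CommRing R] {X : Type*} [TopologicalSpace X]

/-- The `i`-th face of a singular simplex. -/
def face {n : ℕ} (σ : Simplex (n + 1) X) (i : Fin (n + 2)) : Simplex n X :=
  σ.comp (faceMap n i)

variable (X) in
/-- Singular `n`-chains with coefficients in `R`. -/
def Chain (n : ℕ) : Type _ := Simplex n X →₀ R

instance (n : ℕ) : AddCommGroup (Chain R X n) :=
  inferInstanceAs (AddCommGroup (Simplex n X →₀ R))

instance (n : ℕ) : Module R (Chain R X n) :=
  inferInstanceAs (Module R (Simplex n X →₀ R))

/-- A singular simplex, seen as a chain. -/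
def single {n : ℕ} (σ : Simplex n X) : Chain R X n := Finsupp.single σ (1 : R)

/-- The extension by linearity to the chains of a function on the singular simplices. -/
def extend {n : ℕ} {V : Type*} [AddCommGroup V] [Module R V] (F : Simplex n X → V) :
    Chain R X n →ₗ[R] V :=
  Finsupp.linearCombination R F

@[simp]
theorem extend_single {n : ℕ} {V : Type*} [AddCommGroup V] [Module R V] (F : Simplex n X → V)
    (σ : Simplex n X) : extend R F (single R σ) = F σ := by
  have h := Finsupp.linearCombination_single R (1 : R) σ (v := F)
  rw [one_smul] at h
  exact h

theorem chain_hom_ext {n : ℕ} {V : Type*} [AddCommGroup V] [Module R V]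
    {f g : Chain R X n →ₗ[R] V} (h : ∀ σ, f (single R σ) = g (single R σ)) : f = g :=
  Finsupp.lhom_ext' fun σ => LinearMap.ext_ring (h σ)

theorem extend_sub {n : ℕ} {V : Type*} [AddCommGroup V] [Module R V] (F G : Simplex n X → V) :
    extend R (F - G) = extend R F - extend R G :=
  chain_hom_ext R fun σ => by simp

variable (X) in
/-- The boundary map on singular chains, `∂σ = ∑ (-1)^i (i-th face of σ)`. -/
def boundary (n : ℕ) : Chain R X (n + 1) →ₗ[R] Chain R X n :=
  extend R fun σ : Simplex (n + 1) X =>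
    ∑ i : Fin (n + 2), ((-1 : ℤ) ^ (i : ℕ)) • single R (face σ i)

variable (X) in
/-- Singular 1-cycles. -/
abbrev Cycles : Submodule R (Chain R X 1) := LinearMap.ker (boundary R X 0)

variable (X) in
/-- Singular 1-boundaries, seen inside the 1-cycles. -/
abbrev Boundaries : Submodule R (Cycles R X) :=
  (LinearMap.range (boundary R X 1)).submoduleOf (Cycles R X)

variable (X) in
/-- The first singular homology `H₁(X, R)`. -/
abbrev H1 : Type _ := Cycles R X ⧸ Boundaries R X

variable (X) in
/-- The coboundary map on real singular cochains. -/
def coboundary (n : ℕ) : (Simplex n X → ℝ) →ₗ[ℝ] (Simplex (n + 1) X → ℝ) where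
  toFun c σ := ∑ i : Fin (n + 2), ((-1 : ℤ) ^ (i : ℕ)) • c (face σ i)
  map_add' c c' := by
    funext σ
    simp [Finset.sum_add_distrib]
  map_smul' a c := by
    funext σ
    simp only [Pi.smul_apply, RingHom.id_apply, Finset.smul_sum]
    exact Finset.sum_congr rfl fun i _ => smul_comm _ _ _

variable (X) in
/-- Real singular 1-cocycles. -/
abbrev Cocycles : Submodule ℝ (Simplex 1 X → ℝ) := LinearMap.ker (coboundary X 1)

variable (X) in
/-- The first real singular cohomology `H¹(X, ℝ)`: cocycles modulo coboundaries. -/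
abbrev Cohomology : Type _ :=
  Cocycles X ⧸ (LinearMap.range (coboundary X 0)).submoduleOf (Cocycles X)

section pairing

variable [Module R ℝ]

theorem extend_boundary {n : ℕ} (c : Simplex n X → ℝ) (z : Chain R X (n + 1)) :
    extend R c (boundary R X n z) = extend R (coboundary X n c) z := by
  have h : (extend R c).comp (boundary R X n) = extend R (coboundary X n c) :=
    chain_hom_ext R fun σ => by
      simp [boundary, coboundary, map_sum, -zsmul_eq_mul]
  exact LinearMap.congr_fun h z

/-- A cocycle, evaluated on homology classes. -/
def evalCocycle (c : Cocycles X) : H1 R X →ₗ[R] ℝ :=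
  Submodule.liftQ _ ((extend R c.1).comp (Cycles R X).subtype) <| by
    rintro ⟨z, hz⟩ ⟨w, hw⟩
    have hw' : boundary R X 1 w = z := hw
    have hc : coboundary X 1 c.1 = 0 := c.2
    have h := extend_boundary R c.1 w
    have h0 : extend R (0 : Simplex 2 X → ℝ) = 0 := chain_hom_ext R fun σ => by simp
    rw [hw', hc, h0] at h
    exact h

/-- The Kronecker pairing `α ↦ (δ ↦ α(δ))` of `H¹(X, ℝ)` with `H₁(X, R)` (for `R = ℤ` and
`R = ℝ`): a class is evaluated on cycles through any of its cocycles. -/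
def eval (α : Cohomology X) : H1 R X →ₗ[R] ℝ :=
  Quotient.liftOn' α (evalCocycle R) <| by
    intro c c' h
    rw [Submodule.quotientRel_def] at h
    obtain ⟨b, hb⟩ := h
    have hb' : coboundary X 0 b = c.1 - c'.1 := hb
    refine Submodule.linearMap_qext _ (LinearMap.ext fun z => ?_)
    have h0 : extend R (coboundary X 0 b) z.1 = 0 := by
      rw [← extend_boundary, show boundary R X 0 z.1 = 0 from z.2, map_zero]
    have h1 : extend R c.1 z.1 - extend R c'.1 z.1 = 0 := by
      rw [← h0, hb', extend_sub]
      rfl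
    exact sub_eq_zero.1 h1

end pairing

/-! ### Curves as singular simplices -/

/-- A curve `[0,1] → X` as a singular 1-simplex. -/
def curveSimplex (p : C(unitInterval, X)) : Simplex 1 X :=
  p.comp (stdSimplexHomeomorphUnitInterval : C(stdSimplex ℝ (Fin 2), unitInterval))

/-- A curve as a singular 1-chain. -/
def curveChain (p : C(unitInterval, X)) : Chain R X 1 := single R (curveSimplex p)

/-- A point as a singular 0-simplex. -/
def pointSimplex (x : X) : Simplex 0 X := ContinuousMap.const _ x

theorem face_curveSimplex_zero (p : C(unitInterval, X)) :
    face (curveSimplex p) 0 = pointSimplex (p 1) := by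
  ext v
  have hv : v = stdSimplex.vertex 0 := Subsingleton.elim _ _
  subst hv
  simp only [face, curveSimplex, faceMap, pointSimplex, ContinuousMap.comp_apply,
    ContinuousMap.coe_mk, ContinuousMap.const_apply, stdSimplex.map_vertex]
  rfl

theorem face_curveSimplex_one (p : C(unitInterval, X)) :
    face (curveSimplex p) 1 = pointSimplex (p 0) := by
  ext v
  have hv : v = stdSimplex.vertex 0 := Subsingleton.elim _ _
  subst hv
  simp only [face, curveSimplex, faceMap, pointSimplex, ContinuousMap.comp_apply,
    ContinuousMap.coe_mk, ContinuousMap.const_apply, stdSimplex.map_vertex]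
  rfl

theorem boundary_curveChain (p : C(unitInterval, X)) :
    boundary R X 0 (curveChain R p) =
      single R (pointSimplex (p 1)) - single R (pointSimplex (p 0)) := by
  simp [boundary, curveChain, Fin.sum_univ_two, face_curveSimplex_zero, face_curveSimplex_one,
    sub_eq_add_neg]

/-- The homology class of a closed curve. -/
def loopClass (p : C(unitInterval, X)) (h : p 0 = p 1) : H1 R X :=
  Submodule.Quotient.mk ⟨curveChain R p, by
    rw [LinearMap.mem_ker, boundary_curveChain, h, sub_self]⟩

/-- The homology class of the cycle `p - q`, for two curves with the same ends. -/
def diffClass (p q : C(unitInterval, X)) (h0 : p 0 = q 0) (h1 : p 1 = q 1) : H1 R X :=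
  Submodule.Quotient.mk ⟨curveChain R p - curveChain R q, by
    rw [LinearMap.mem_ker, map_sub, boundary_curveChain, boundary_curveChain, h0, h1, sub_self]⟩

/-- The map `(x₀, x₁, x₂) ↦ x₁ / 2 + x₂` from the triangle to the unit interval. -/
def triangleMap : C(stdSimplex ℝ (Fin 3), unitInterval) :=
  ⟨fun v => ⟨v.1 1 / 2 + v.1 2, by
      have h0 := v.2.1 0
      have h1 := v.2.1 1
      have h2 := v.2.1 2
      have h := v.2.2
      rw [Fin.sum_univ_three] at h
      constructor <;> linarith⟩, by
    refine Continuous.subtype_mk ?_ _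
    exact (((continuous_apply 1).comp continuous_subtype_val).div_const 2).add
      ((continuous_apply 2).comp continuous_subtype_val)⟩

theorem triangleMap_face_zero (v : stdSimplex ℝ (Fin 2)) :
    (triangleMap (faceMap 1 0 v) : ℝ) = (1 + v.1 1) / 2 := by
  have h := v.2.2
  rw [Fin.sum_univ_two] at h
  have h1 : (faceMap 1 0 v).1 1 = v.1 0 := by
    change stdSimplex.map _ v 1 = v 0
    simp [FunOnFinite.linearMap_apply_apply, Finset.sum_filter, Fin.sum_univ_two]
  have h2 : (faceMap 1 0 v).1 2 = v.1 1 := by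
    change stdSimplex.map _ v 2 = v 1
    simp [FunOnFinite.linearMap_apply_apply, Finset.sum_filter, Fin.sum_univ_two, Fin.ext_iff]
  change (faceMap 1 0 v).1 1 / 2 + (faceMap 1 0 v).1 2 = _
  rw [h1, h2]
  linarith

theorem triangleMap_face_one (v : stdSimplex ℝ (Fin 2)) :
    (triangleMap (faceMap 1 1 v) : ℝ) = v.1 1 := by
  have h1 : (faceMap 1 1 v).1 1 = 0 := by
    change stdSimplex.map _ v 1 = 0
    simp [FunOnFinite.linearMap_apply_apply, Fin.succAbove_ne]
  have e0 : (1 : Fin 3).succAbove (0 : Fin 2) ≠ 2 := by decide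
  have e1 : (1 : Fin 3).succAbove (1 : Fin 2) = 2 := by decide
  have h2 : (faceMap 1 1 v).1 2 = v.1 1 := by
    change stdSimplex.map _ v 2 = v 1
    rw [stdSimplex.map_coe, FunOnFinite.linearMap_apply_apply, Finset.sum_filter,
      Fin.sum_univ_two, if_neg e0, if_pos e1, zero_add]
  change (faceMap 1 1 v).1 1 / 2 + (faceMap 1 1 v).1 2 = _
  rw [h1, h2]
  simp

theorem triangleMap_face_two (v : stdSimplex ℝ (Fin 2)) :
    (triangleMap (faceMap 1 2 v) : ℝ) = v.1 1 / 2 := by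
  have h1 : (faceMap 1 2 v).1 1 = v.1 1 := by
    change stdSimplex.map _ v 1 = v 1
    simp [FunOnFinite.linearMap_apply_apply, Finset.sum_filter, Fin.sum_univ_two, Fin.ext_iff,
      Fin.succAbove]
  have h2 : (faceMap 1 2 v).1 2 = 0 := by
    change stdSimplex.map _ v 2 = 0
    simp [FunOnFinite.linearMap_apply_apply, Fin.succAbove_ne]
  change (faceMap 1 2 v).1 1 / 2 + (faceMap 1 2 v).1 2 = _
  rw [h1, h2, add_zero]

/-- A concatenation of curves is homologous to their sum. -/
theorem curveChain_trans {x y z : X} (p : Path x y) (q : Path y z) :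
    curveChain R p.toContinuousMap + curveChain R q.toContinuousMap
      - curveChain R (p.trans q).toContinuousMap ∈ LinearMap.range (boundary R X 1) := by
  have hnn : ∀ v : stdSimplex ℝ (Fin 2), 0 ≤ v.1 1 ∧ v.1 1 ≤ 1 := fun v =>
    mem_Icc_of_mem_stdSimplex v.2 1
  have f0 : face ((p.trans q).toContinuousMap.comp triangleMap) 0
      = curveSimplex q.toContinuousMap := by
    ext v
    change (p.trans q) (triangleMap (faceMap 1 0 v)) = q (stdSimplexHomeomorphUnitInterval v)
    rw [Path.trans_apply]
    split_ifs with h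
    · have hv : v.1 1 = 0 := by
        have h' := triangleMap_face_zero v
        have := hnn v
        linarith
      have e1 : (⟨2 * (triangleMap (faceMap 1 0 v) : ℝ),
          (unitInterval.mul_pos_mem_iff zero_lt_two).2 ⟨(triangleMap _).2.1, h⟩⟩ :
            unitInterval) = 1 := by
        ext1
        change 2 * (triangleMap (faceMap 1 0 v) : ℝ) = 1
        rw [triangleMap_face_zero, hv]
        norm_num
      have e2 : stdSimplexHomeomorphUnitInterval v = 0 := Subtype.ext hv
      rw [e1, e2, p.target, q.source]
    · congr 1
      ext1
      change 2 * (triangleMap (faceMap 1 0 v) : ℝ) - 1 = v.1 1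
      rw [triangleMap_face_zero]
      ring
  have f1 : face ((p.trans q).toContinuousMap.comp triangleMap) 1
      = curveSimplex (p.trans q).toContinuousMap := by
    ext v
    change (p.trans q) (triangleMap (faceMap 1 1 v))
      = (p.trans q) (stdSimplexHomeomorphUnitInterval v)
    congr 1
    ext1
    exact triangleMap_face_one v
  have f2 : face ((p.trans q).toContinuousMap.comp triangleMap) 2
      = curveSimplex p.toContinuousMap := by
    ext v
    change (p.trans q) (triangleMap (faceMap 1 2 v)) = p (stdSimplexHomeomorphUnitInterval v)
    have h : (triangleMap (faceMap 1 2 v) : ℝ) ≤ 1 / 2 := by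
      rw [triangleMap_face_two]
      have := hnn v
      linarith
    rw [Path.trans_apply, dif_pos h]
    congr 1
    ext1
    change 2 * (triangleMap (faceMap 1 2 v) : ℝ) = v.1 1
    rw [triangleMap_face_two]
    ring
  refine ⟨single R ((p.trans q).toContinuousMap.comp triangleMap), ?_⟩
  have hb : boundary R X 1 (single R ((p.trans q).toContinuousMap.comp triangleMap)) =
      ∑ i : Fin 3, ((-1 : ℤ) ^ (i : ℕ)) •
        single R (face ((p.trans q).toContinuousMap.comp triangleMap) i) :=
    extend_single R _ _
  rw [hb, Fin.sum_univ_three, f0, f1, f2]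
  simp only [curveChain, Fin.val_zero, Fin.val_one, Fin.val_two, pow_zero, pow_one, one_smul,
    neg_smul, even_two, Even.neg_pow, one_pow]
  abel

/-! ### The Abelian coverings -/

/-- The curves in `X` that start at `x₀`, with the compact-open topology. -/
abbrev PathSpace (x₀ : X) : Type _ := {p : C(unitInterval, X) // p 0 = x₀}

namespace PathSpace

variable {x₀ : X}

/-- The end of a curve. -/
def endpoint (p : PathSpace x₀) : X := p.1 1

/-- An element of the path space as a path. -/
def toPath (p : PathSpace x₀) : Path x₀ p.endpoint := ⟨p.1, p.2, rfl⟩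

/-- The curve `p` followed by the curve `a`. -/
def append (p : PathSpace x₀) {y : X} (a : Path p.endpoint y) : PathSpace x₀ :=
  ⟨(p.toPath.trans a).toContinuousMap, (p.toPath.trans a).source⟩

theorem endpoint_append (p : PathSpace x₀) {y : X} (a : Path p.endpoint y) :
    (p.append a).endpoint = y :=
  (p.toPath.trans a).target

/-- The class in `H₁(X, ℤ)` of `p - q`, for two curves that start at `x₀` and have the same
end. -/
def diff (p q : PathSpace x₀) (h : p.endpoint = q.endpoint) : H1 ℤ X :=
  diffClass ℤ p.1 q.1 (p.2.trans q.2.symm) h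

end PathSpace

/-- Two curves that start at `x₀` are identified when they have the same end and when their
difference lies in the subgroup `K` of `H₁(X, ℤ)`. -/
def coverSetoid (x₀ : X) (K : Submodule ℤ (H1 ℤ X)) : Setoid (PathSpace x₀) where
  r p q := ∃ h : p.endpoint = q.endpoint, p.diff q h ∈ K
  iseqv := by
    refine ⟨fun p => ⟨rfl, ?_⟩, ?_, ?_⟩
    · have h : p.diff p rfl = 0 := by
        simp only [PathSpace.diff, diffClass, sub_self]
        rfl
      rw [h]
      exact K.zero_mem
    · rintro p q ⟨h, hK⟩
      refine ⟨h.symm, ?_⟩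
      have h' : q.diff p h.symm = -p.diff q h := by
        simp only [PathSpace.diff, diffClass, ← Submodule.Quotient.mk_neg]
        congr 1
        ext1
        simp
      rw [h']
      exact K.neg_mem hK
    · rintro p q r ⟨h, hK⟩ ⟨h', hK'⟩
      refine ⟨h.trans h', ?_⟩
      have e : p.diff r (h.trans h') = p.diff q h + q.diff r h' := by
        simp only [PathSpace.diff, diffClass, ← Submodule.Quotient.mk_add]
        congr 1
        ext1
        simp
      rw [e]
      exact K.add_mem hK hK'

/-- The connected Abelian covering of `X` whose closed curves are the closed curves of `X` with
homology class in `K ≤ H₁(X, ℤ)`, with the quotient topology. For `K = ⊥` this is the universal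
Abelian covering, and for general `K` its quotient by `K`. -/
def Cover (x₀ : X) (K : Submodule ℤ (H1 ℤ X)) : Type _ := Quotient (coverSetoid x₀ K)

namespace Cover

variable {x₀ : X} {K : Submodule ℤ (H1 ℤ X)}

instance : TopologicalSpace (Cover x₀ K) :=
  inferInstanceAs (TopologicalSpace (Quotient (coverSetoid x₀ K)))

/-- The point of the covering represented by a curve. -/
def mk (K : Submodule ℤ (H1 ℤ X)) (p : PathSpace x₀) : Cover x₀ K :=
  Quotient.mk (coverSetoid x₀ K) p

/-- The covering map. -/
def proj (x : Cover x₀ K) : X :=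
  Quotient.liftOn x PathSpace.endpoint fun _ _ h => h.1

/-- `IsTranslate δ x y` says that `y = δ · x`, for the action of `H₁(X, ℤ)` by deck
transformations: `y` is represented by `ℓ · p` and `x` by `p`, with `ℓ` a loop of class `δ`. -/
def IsTranslate (δ : H1 ℤ X) (x y : Cover x₀ K) : Prop :=
  ∃ (p q : PathSpace x₀) (h : q.endpoint = p.endpoint),
    mk K p = x ∧ mk K q = y ∧ q.diff p h = δ

end Cover

/-- A real function on a covering is `α`-equivariant if `f (δ · x) = α(δ) + f x`. -/
def IsEquivariant {x₀ : X} {K : Submodule ℤ (H1 ℤ X)} (α : Cohomology X)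
    (f : Cover x₀ K → ℝ) : Prop :=
  ∀ (δ : H1 ℤ X) (x y : Cover x₀ K), Cover.IsTranslate δ x y → f y = eval ℤ α δ + f x

/-- `ker_ℤ(α) ⊆ H₁(X, ℤ)`. -/
abbrev intKer (α : Cohomology X) : Submodule ℤ (H1 ℤ X) := LinearMap.ker (eval ℤ α)

/-- The orbit arc `s ↦ φ_{st}(x)`, `0 ≤ s ≤ 1`, from `x` to `φ_t(x)`. -/
def orbitArc (φ : Flow ℝ X) (t : ℝ) (x : X) : Path x (φ t x) where
  toFun s := φ (s * t) x
  continuous_toFun := φ.continuous (by fun_prop) continuous_const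
  source' := by simp [φ.map_zero_apply]
  target' := by simp

theorem diff_append {x₀ : X} (p q : PathSpace x₀) (h : p.endpoint = q.endpoint) {y z : X}
    (a : Path p.endpoint y) (b : Path q.endpoint z)
    (hab : a.toContinuousMap = b.toContinuousMap)
    (h' : (p.append a).endpoint = (q.append b).endpoint) :
    (p.append a).diff (q.append b) h' = p.diff q h := by
  have e := Submodule.sub_mem _ (curveChain_trans ℤ q.toPath b) (curveChain_trans ℤ p.toPath a)
  refine (Submodule.Quotient.eq _).2 ?_
  change curveChain ℤ (p.toPath.trans a).toContinuousMap
      - curveChain ℤ (q.toPath.trans b).toContinuousMap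
      - (curveChain ℤ p.toPath.toContinuousMap - curveChain ℤ q.toPath.toContinuousMap)
      ∈ LinearMap.range (boundary ℤ X 1)
  rw [hab] at e
  convert e using 1
  abel

/-- The lift of a flow to a covering: the curve `p` is prolonged by the orbit of its end. -/
def liftFlow (φ : Flow ℝ X) {x₀ : X} {K : Submodule ℤ (H1 ℤ X)} (t : ℝ) :
    Cover x₀ K → Cover x₀ K :=
  Quotient.map (fun p => p.append (orbitArc φ t p.endpoint)) <| by
    rintro p q ⟨h, hK⟩
    have h' : (p.append (orbitArc φ t p.endpoint)).endpoint
        = (q.append (orbitArc φ t q.endpoint)).endpoint := by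
      rw [PathSpace.endpoint_append, PathSpace.endpoint_append, h]
    refine ⟨h', ?_⟩
    rw [diff_append p q h _ _ (by rw [h]) h']
    exact hK

/-! ### Metrics on the coverings -/

/-- `d` is one of the metrics used on a covering of the metric space `X`: it is a metric that
induces the topology, it is invariant under deck transformations, and the covering map restricted
to any small enough ball is an isometry onto its image. -/
structure IsLiftedMetric {X : Type*} [MetricSpace X] {x₀ : X} {K : Submodule ℤ (H1 ℤ X)}
    (d : Cover x₀ K → Cover x₀ K → ℝ) : Prop where
  eq_zero_iff : ∀ x y, d x y = 0 ↔ x = y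
  symm : ∀ x y, d x y = d y x
  triangle : ∀ x y z, d x z ≤ d x y + d y z
  isOpen_iff : ∀ U : Set (Cover x₀ K), IsOpen U ↔ ∀ x ∈ U, ∃ η > 0, ∀ y, d x y < η → y ∈ U
  deck_invariant : ∀ (δ : H1 ℤ X) (x y x' y' : Cover x₀ K),
    Cover.IsTranslate δ x x' → Cover.IsTranslate δ y y' → d x' y' = d x y
  isometry_on_balls : ∃ r > 0, ∀ x y z : Cover x₀ K, d x y < r → d x z < r →
    dist y.proj z.proj = d y z

/-! ### Pseudo-orbits -/

/-- The `(ε, T)`-pseudo-orbits `γ : [0, l[ → N` of `ψ` (values outside `[0, l[` are ignored).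
The discontinuity set is finite, disjoint from `[0, T[`, and its points are distant by at least
`T`. -/
structure IsPseudoOrbit {N : Type*} [TopologicalSpace N] (ψ : ℝ → N → N) (d : N → N → ℝ)
    (ε T l : ℝ) (γ : ℝ → N) : Prop where
  length_pos : 0 < l
  right_continuous : ∀ t ∈ Ico 0 l, ContinuousWithinAt γ (Ico t l) t
  finite : {u ∈ Ico 0 l | ¬ ContinuousWithinAt γ (Ico 0 l) u}.Finite
  disjoint : ∀ u ∈ Ico 0 l, ¬ ContinuousWithinAt γ (Ico 0 l) u → T ≤ u
  spacing : ∀ u ∈ Ico 0 l, ∀ v ∈ Ico 0 l, ¬ ContinuousWithinAt γ (Ico 0 l) u →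
    ¬ ContinuousWithinAt γ (Ico 0 l) v → u < v → T ≤ v - u
  orbit : ∀ t s, 0 ≤ t → t ≤ s → s < l → ContinuousOn γ (Icc t s) → γ s = ψ (s - t) (γ t)
  jump : ∀ u ∈ Ico 0 l, ¬ ContinuousWithinAt γ (Ico 0 l) u →
    ∃ y, Tendsto γ (𝓝[<] u) (𝓝 y) ∧ d (γ u) y < ε

section

variable {M : Type*} [MetricSpace M]

/-- The periodic `(ε, T)`-pseudo-orbits `γ : ℝ / lℤ → M`, seen as `l`-periodic functions on
`ℝ`. -/
structure IsPeriodicPseudoOrbit (φ : Flow ℝ M) (ε T l : ℝ) (γ : ℝ → M) : Prop where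
  length_pos : 0 < l
  periodic : Function.Periodic γ l
  right_continuous : ∀ t, ContinuousWithinAt γ (Ici t) t
  finite : {u ∈ Ico 0 l | ¬ ContinuousAt γ u}.Finite
  spacing : ∀ u v, ¬ ContinuousAt γ u → ¬ ContinuousAt γ v → u < v → T ≤ v - u
  orbit : ∀ t s, t ≤ s → ContinuousOn γ (Icc t s) → γ s = φ (s - t) (γ t)
  jump : ∀ u, ¬ ContinuousAt γ u → ∃ y, Tendsto γ (𝓝[<] u) (𝓝 y) ∧ dist (γ u) y < ε

/-- `Γ` is an `ε`-realization of the periodic pseudo-orbit `γ` of length `l`: a closed curve that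
runs through `γ` once and in which, at each discontinuity time `u`, a curve from `γ(u⁻)` to `γ(u)`
in the `ε`-ball centred at `γ(u)` is inserted. The function `τ` sends the parameter of `Γ` to the
time of `γ`; it is constant equal to `u` on the inserted curve, whose ends are `γ(u⁻)` and `γ(u)`
by continuity of `Γ`. -/
structure IsRealization (ε l : ℝ) (γ : ℝ → M) (Γ : C(unitInterval, M)) : Prop where
  closed : Γ 0 = Γ 1
  exists_time : ∃ τ : C(unitInterval, ℝ), Monotone τ ∧ τ 1 = τ 0 + l ∧
    ∀ s, (ContinuousAt γ (τ s) → Γ s = γ (τ s)) ∧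
      (¬ ContinuousAt γ (τ s) → Γ s ∈ Metric.ball (γ (τ s)) ε)

/-- `h = [γ]`: the class `h` in `H₁(M, ℝ)` is the class of an `ε`-realization of the periodic
pseudo-orbit `γ` of length `l`. -/
def IsClassOf (ε l : ℝ) (γ : ℝ → M) (h : H1 ℝ M) : Prop :=
  ∃ (Γ : C(unitInterval, M)) (hΓ : IsRealization ε l γ Γ), h = loopClass ℝ Γ hΓ.closed

variable (M) in
/-- `ε` is small: any two curves with the same ends that remain in a common `ε`-ball are
homotopic in `M` relatively to their ends. -/
def IsSmall (ε : ℝ) : Prop :=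
  ∀ (z x y : M) (p q : Path x y), (∀ t, p t ∈ Metric.ball z ε) → (∀ t, q t ∈ Metric.ball z ε) →
    p.Homotopic q

/-- The set `D_{φ,ε,T}`: the closure in `H₁(M, ℝ)` of the set of all `[γ] / len(γ)`, for the
periodic `(ε, T)`-pseudo-orbits `γ`. The topology on the real vector space `H₁(M, ℝ)` is its
canonical one (in finite dimension, the unique Hausdorff vector space topology). -/
def pseudoDirections (φ : Flow ℝ M) (ε T : ℝ) : Set (H1 ℝ M) :=
  @closure (H1 ℝ M) (moduleTopology ℝ (H1 ℝ M))
    {v | ∃ (l : ℝ) (γ : ℝ → M) (h : H1 ℝ M),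
      IsPeriodicPseudoOrbit φ ε T l γ ∧ IsClassOf ε l γ h ∧ v = l⁻¹ • h}

/-! ### Quasi-Lyapunov classes -/

variable {x₀ : M} {K : Submodule ℤ (H1 ℤ M)}

/-- `f` is `C`-quasi-Lyapunov for the lifted flow. -/
def IsQuasiLyapunovMapWith (φ : Flow ℝ M) (T : ℝ) (d : Cover x₀ K → Cover x₀ K → ℝ)
    (C : ℝ) (f : Cover x₀ K → ℝ) : Prop :=
  ∃ ε > 0, ∀ (l : ℝ) (γ : ℝ → Cover x₀ K), IsPseudoOrbit (liftFlow φ) d ε T l γ →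
    ∀ t ∈ Ico 0 l, f (γ 0) ≥ f (γ t) - C

/-- `f` is quasi-Lyapunov. -/
def IsQuasiLyapunovMap (φ : Flow ℝ M) (T : ℝ) (d : Cover x₀ K → Cover x₀ K → ℝ)
    (f : Cover x₀ K → ℝ) : Prop :=
  ∃ C ≥ 0, IsQuasiLyapunovMapWith φ T d C f

/-- `α` is quasi-Lyapunov: on the covering (with metric `d`), every continuous `α`-equivariant
function is quasi-Lyapunov. -/
def IsQuasiLyapunov (φ : Flow ℝ M) (T : ℝ) (d : Cover x₀ K → Cover x₀ K → ℝ)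
    (α : Cohomology M) : Prop :=
  ∀ f : Cover x₀ K → ℝ, Continuous f → IsEquivariant α f → IsQuasiLyapunovMap φ T d f

end

end QuasiLyapunov

end

open QuasiLyapunov

open Set Filter Topology

noncomputable section

namespace QuasiLyapunov

/-! Fix a cocycle `c` representing the class. On a covering whose group `K` lies in its integral
kernel, the value of `c` on a curve representing a point depends only on that point: this is
`primitive c`. A function is equivariant exactly when it differs from this primitive by a function
on the base (`isEquivariant_iff`). Both coverings are instances of this situation, with `K` the
integral kernel or `⊥`, so each implication is proved once for general `K`. Lifting is expressed by
the relation `Link`, which compares chains modulo boundaries; lifts are unique, and two lifts of one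
curve differ by a single deck transformation (`Link.translate`). Estimates on the covering, which
need not be compact, therefore reduce to estimates on the compact base.

From periodic pseudo-orbits to functions (`isQuasiLyapunov_of_forall_periodic`): cut a pseudo-orbit
of the covering into arcs of bounded length, along each of which an equivariant `f` grows by a
bounded amount. Colour the cut points by a finite net of the base. Between two cut points of the
same colour the chain almost closes up in the base, hence it gives a periodic pseudo-orbit after a
small change; its class is nonpositive, so `f` grows by at most 1. A bounded-increment sequence with
this recurrence property grows by an amount controlled by the number of colours alone.

Conversely (`IsQuasiLyapunov.exists_forall_periodic`): run a periodic pseudo-orbit `k` times and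
lift it through a realization. Any equivariant function changes by `k` times the value of the class,
which contradicts a uniform bound if that value is positive. This needs one continuous equivariant
function, supplied by `exists_equivariant`.

The conditions on directions reduce to those on periodic pseudo-orbits because lengths are positive
and a closed half-space contains the closure of its subsets. All sufficiently small scales may be
taken because a pseudo-orbit at one scale is also one at any larger scale. -/

/-! ### Local topology of the manifold -/

theorem locallyPathConnectedSpace_of_modelWithCorners {E H : Type*} [NormedAddCommGroup E]
    [NormedSpace ℝ E] [TopologicalSpace H] (I : ModelWithCorners ℝ E H) (M : Type*)
    [TopologicalSpace M] [ChartedSpace H M] : LocallyPathConnectedSpace M := by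
  have : LocallyPathConnectedSpace (range I) := I.convex_range.locallyPathConnectedSpace
  have : LocallyPathConnectedSpace H :=
    (I.isClosedEmbedding.isEmbedding.toHomeomorph.isOpenEmbedding).locallyPathConnectedSpace
  exact ChartedSpace.locallyPathConnectedSpace H M

/-- Around each point of a manifold, any two paths with the same ends that stay in a small enough
open set are homotopic. -/
theorem exists_isOpen_forall_homotopic {E H : Type*} [NormedAddCommGroup E]
    [NormedSpace ℝ E] [TopologicalSpace H] (I : ModelWithCorners ℝ E H) {M : Type*}
    [TopologicalSpace M] [ChartedSpace H M] (z : M) :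
    ∃ U : Set M, IsOpen U ∧ z ∈ U ∧ ∀ (x y : M) (p q : Path x y), (∀ t, p t ∈ U) →
      (∀ t, q t ∈ U) → p.Homotopic q := by
  set e := extChartAt I z
  have htar : e.target ∈ 𝓝[range I] (e z) := extChartAt_target_mem_nhdsWithin z
  obtain ⟨ρ, hρ, hsub⟩ := Metric.mem_nhdsWithin_iff.1 htar
  refine ⟨e.source ∩ e ⁻¹' Metric.ball (e z) ρ, ?_, ?_, ?_⟩
  · exact (continuousOn_extChartAt z).isOpen_inter_preimage (isOpen_extChartAt_source z)
      Metric.isOpen_ball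
  · exact ⟨mem_extChartAt_source z, Metric.mem_ball_self hρ⟩
  intro x y p q hp hq
  have hconv : Convex ℝ (Metric.ball (e z) ρ ∩ range I) :=
    (convex_ball _ _).inter I.convex_range
  have hmem : ∀ u ∈ e.source ∩ e ⁻¹' Metric.ball (e z) ρ,
      e u ∈ Metric.ball (e z) ρ ∩ range I := fun u hu =>
    ⟨hu.2, extChartAt_target_subset_range z (e.map_source hu.1)⟩
  have hpc : Continuous fun t => e (p t) :=
    (continuousOn_extChartAt z).comp_continuous p.continuous fun t => (hp t).1
  have hqc : Continuous fun t => e (q t) :=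
    (continuousOn_extChartAt z).comp_continuous q.continuous fun t => (hq t).1
  -- Straight-line homotopy in the chart. It stays in the chart's target because the range of the
  -- model, also at boundary points, is convex.
  let F : unitInterval × unitInterval → E := fun s =>
    (1 - (s.1 : ℝ)) • e (p s.2) + (s.1 : ℝ) • e (q s.2)
  have hF : Continuous F := by
    refine Continuous.add ?_ ?_
    · exact (by fun_prop : Continuous fun s : unitInterval × unitInterval => 1 - (s.1 : ℝ)).smul
        (hpc.comp continuous_snd)
    · exact (by fun_prop : Continuous fun s : unitInterval × unitInterval => (s.1 : ℝ)).smul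
        (hqc.comp continuous_snd)
  have hFt : ∀ s, F s ∈ e.target := fun s =>
    hsub (hconv (hmem _ (hp s.2)) (hmem _ (hq s.2)) (sub_nonneg.2 s.1.2.2) s.1.2.1 (by ring))
  refine ⟨⟨⟨⟨fun s => e.symm (F s), ?_⟩, ?_, ?_⟩, ?_⟩⟩
  · exact (continuousOn_extChartAt_symm z).comp_continuous hF hFt
  · intro t
    change e.symm (F (0, t)) = p t
    simp only [F, Icc.coe_zero, sub_zero, one_smul, zero_smul, add_zero]
    exact e.left_inv (hp t).1
  · intro t
    change e.symm (F (1, t)) = q t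
    simp only [F, Icc.coe_one, sub_self, one_smul, zero_smul, zero_add]
    exact e.left_inv (hq t).1
  · intro s t ht
    have key : ∀ w : unitInterval, p w = q w → e.symm (F (s, w)) = p w := by
      intro w hw
      simp only [F, ← hw, ← add_smul, sub_add_cancel, one_smul]
      exact e.left_inv (hp w).1
    rcases ht with rfl | rfl
    · exact key 0 (by simp)
    · exact key 1 (by simp)

theorem IsSmall.mono {M : Type*} [MetricSpace M] {ε ε' : ℝ} (h : IsSmall M ε) (hε : ε' ≤ ε) :
    IsSmall M ε' := fun z _ _ p q hp hq =>
  h z _ _ p q (fun t => Metric.ball_subset_ball hε (hp t))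
    fun t => Metric.ball_subset_ball hε (hq t)

/-- A Lebesgue number of the cover by the open sets of `exists_isOpen_forall_homotopic`. -/
theorem exists_isSmall {E H : Type*} [NormedAddCommGroup E]
    [NormedSpace ℝ E] [TopologicalSpace H] (I : ModelWithCorners ℝ E H) (M : Type*)
    [MetricSpace M] [CompactSpace M] [ChartedSpace H M] : ∃ ε > 0, IsSmall M ε := by
  choose U hU hz hU' using exists_isOpen_forall_homotopic I (M := M)
  obtain ⟨ε, hε, h⟩ := lebesgue_number_lemma_of_metric isCompact_univ hU
    fun z _ => mem_iUnion.2 ⟨z, hz z⟩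
  refine ⟨ε, hε, fun z x y p q hp hq => ?_⟩
  obtain ⟨i, hi⟩ := h z (mem_univ z)
  exact hU' i x y p q (fun t => hi (hp t)) fun t => hi (hq t)

section

variable {M : Type*} [MetricSpace M] [LocallyPathConnectedSpace M]

/-- Points close to `x` are joined to `x` inside a given ball. -/
theorem exists_joinedIn_ball (x : M) {η : ℝ} (hη : 0 < η) :
    ∃ ε > 0, ∀ y ∈ Metric.ball x ε, JoinedIn (Metric.ball x η) x y := by
  obtain ⟨V, ⟨hV, hVc⟩, hVs⟩ := (path_connected_basis x).mem_iff.1 (Metric.ball_mem_nhds x hη)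
  obtain ⟨ε, hε, h⟩ := Metric.mem_nhds_iff.1 hV
  exact ⟨ε, hε, fun y hy => (hVc.joinedIn x (mem_of_mem_nhds hV) y (h hy)).mono hVs⟩

variable [CompactSpace M]

/-- A compact locally path connected metric space is uniformly locally path connected. -/
theorem exists_forall_joinedIn_ball {η : ℝ} (hη : 0 < η) :
    ∃ ε > 0, ∀ x y : M, dist x y < ε → JoinedIn (Metric.ball x η) x y := by
  choose ρ hρ h using fun x : M => exists_joinedIn_ball x (half_pos hη)
  -- The bound `η / 2` on the radii keeps the centre `z` found below within `η / 2` of `x`, so that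
  -- the `η / 2`-ball at `z` lies in the `η`-ball at `x`.
  obtain ⟨ε, hε, hL⟩ := lebesgue_number_lemma_of_metric (isCompact_univ (X := M))
    (c := fun x => Metric.ball x (min (ρ x) (η / 2))) (fun _ => Metric.isOpen_ball)
    fun z _ => mem_iUnion.2 ⟨z, Metric.mem_ball_self (lt_min (hρ z) (half_pos hη))⟩
  refine ⟨ε, hε, fun x y hxy => ?_⟩
  obtain ⟨z, hz⟩ := hL x (mem_univ x)
  have hx := hz (Metric.mem_ball_self hε)
  have hy := hz (Metric.mem_ball'.2 hxy)
  have hzx : dist z x < η / 2 := (Metric.mem_ball'.1 hx).trans_le (min_le_right _ _)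
  have hsub : Metric.ball z (η / 2) ⊆ Metric.ball x η := by
    refine Metric.ball_subset_ball' ?_
    linarith
  exact ((h z x (Metric.ball_subset_ball (min_le_left _ _) hx)).symm.trans
    (h z y (Metric.ball_subset_ball (min_le_left _ _) hy))).mono hsub

end

/-! ### Segments of curves and values of cocycles -/

section chains

variable {X : Type*} [TopologicalSpace X]

/-- The restriction of `P` to the segment from `a` to `b`, parametrized by `[0,1]`. -/
def seg (P : C(ℝ, X)) (a b : ℝ) : C(unitInterval, X) :=
  ⟨fun t => P (a + (b - a) * t), by fun_prop⟩

@[simp] theorem seg_apply (P : C(ℝ, X)) (a b : ℝ) (t : unitInterval) :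
    seg P a b t = P (a + (b - a) * t) := rfl

theorem seg_zero (P : C(ℝ, X)) (a b : ℝ) : seg P a b 0 = P a := by simp

theorem seg_one (P : C(ℝ, X)) (a b : ℝ) : seg P a b 1 = P b := by simp

/-- The singular triangle `v ↦ P (a v₀ + b v₁ + e v₂)`. -/
def segTriangle (P : C(ℝ, X)) (k : Fin 3 → ℝ) : Simplex 2 X :=
  ⟨fun v => P (∑ i, k i * v.1 i), by
    refine P.continuous.comp (continuous_finsetSum _ fun i _ => ?_)
    exact continuous_const.mul ((continuous_apply i).comp continuous_subtype_val)⟩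

theorem face_segTriangle (P : C(ℝ, X)) (k : Fin 3 → ℝ) (i : Fin 3) :
    face (segTriangle P k) i = curveSimplex (seg P (k (i.succAbove 0)) (k (i.succAbove 1))) := by
  ext v
  change P (∑ j, k j * (faceMap 1 i v).1 j) =
    P (k (i.succAbove 0) + (k (i.succAbove 1) - k (i.succAbove 0)) *
      (stdSimplexHomeomorphUnitInterval v : ℝ))
  congr 1
  have h := v.2.2
  rw [Fin.sum_univ_two] at h
  have h1 : (stdSimplexHomeomorphUnitInterval v : ℝ) = v.1 1 := rfl
  have h2 : ∀ j, (faceMap 1 i v).1 j =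
      (if i.succAbove 0 = j then v.1 0 else 0) + (if i.succAbove 1 = j then v.1 1 else 0) := by
    intro j
    change stdSimplex.map _ v j = _
    rw [stdSimplex.map_coe, FunOnFinite.linearMap_apply_apply, Finset.sum_filter,
      Fin.sum_univ_two]
    rfl
  simp only [h1, h2, mul_add, Finset.sum_add_distrib, mul_ite, mul_zero, Finset.sum_ite_eq,
    Finset.mem_univ, if_true]
  rw [show v.1 0 = 1 - v.1 1 by linarith]
  ring

/-- The affine triangle with vertices `a`, `b`, `e`, composed with `P`, has exactly these segments
as faces. No order on `a`, `b`, `e` is assumed, so reversed and degenerate segments are included. -/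
theorem curveChain_seg_add (P : C(ℝ, X)) (a b e : ℝ) :
    curveChain ℤ (seg P a b) + curveChain ℤ (seg P b e) - curveChain ℤ (seg P a e)
      ∈ LinearMap.range (boundary ℤ X 1) := by
  refine ⟨single ℤ (segTriangle P ![a, b, e]), ?_⟩
  have hb : boundary ℤ X 1 (single ℤ (segTriangle P ![a, b, e])) =
      ∑ i : Fin 3, ((-1 : ℤ) ^ (i : ℕ)) • single ℤ (face (segTriangle P ![a, b, e]) i) :=
    extend_single ℤ _ _
  rw [hb, Fin.sum_univ_three, face_segTriangle, face_segTriangle, face_segTriangle]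
  have e0 : (0 : Fin 3).succAbove (0 : Fin 2) = 1 := by decide
  have e1 : (0 : Fin 3).succAbove (1 : Fin 2) = 2 := by decide
  have e2 : (1 : Fin 3).succAbove (0 : Fin 2) = 0 := by decide
  have e3 : (1 : Fin 3).succAbove (1 : Fin 2) = 2 := by decide
  have e4 : (2 : Fin 3).succAbove (0 : Fin 2) = 0 := by decide
  have e5 : (2 : Fin 3).succAbove (1 : Fin 2) = 1 := by decide
  rw [e0, e1, e2, e3, e4, e5]
  simp only [curveChain, Fin.val_zero, Fin.val_one, Fin.val_two, pow_zero, pow_one, one_smul,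
    neg_smul, even_two, Even.neg_pow, one_pow, Matrix.cons_val]
  abel

theorem curveChain_const (x : X) :
    curveChain ℤ (ContinuousMap.const _ x) ∈ LinearMap.range (boundary ℤ X 1) := by
  have h := curveChain_seg_add (ContinuousMap.const ℝ x) 0 0 0
  have e : seg (ContinuousMap.const ℝ x) 0 0 = ContinuousMap.const _ x := rfl
  rw [e] at h
  simpa using h

end chains

section cocycles

variable {X : Type*} [TopologicalSpace X]

/-- The value of a cocycle on a curve. -/
def curveValue (c : Cocycles X) (a : C(unitInterval, X)) : ℝ := c.1 (curveSimplex a)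

theorem extend_eq_zero (c : Cocycles X) {z : Chain ℤ X 1}
    (hz : z ∈ LinearMap.range (boundary ℤ X 1)) : extend ℤ c.1 z = 0 := by
  obtain ⟨w, rfl⟩ := hz
  rw [extend_boundary, show coboundary X 1 c.1 = 0 from c.2]
  exact LinearMap.congr_fun (chain_hom_ext ℤ (f := extend ℤ (0 : Simplex 2 X → ℝ)) (g := 0)
    fun σ => by simp) w

theorem extend_curveChain (R : Type) [CommRing R] [Module R ℝ] (c : Cocycles X)
    (a : C(unitInterval, X)) : extend R c.1 (curveChain R a) = curveValue c a :=
  extend_single R _ _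

theorem curveValue_add (c : Cocycles X) {a b e : C(unitInterval, X)}
    (h : curveChain ℤ a + curveChain ℤ b - curveChain ℤ e ∈ LinearMap.range (boundary ℤ X 1)) :
    curveValue c a + curveValue c b = curveValue c e := by
  have := extend_eq_zero c h
  rw [map_sub, map_add, extend_curveChain, extend_curveChain, extend_curveChain] at this
  linarith

theorem curveValue_trans (c : Cocycles X) {x y z : X} (p : Path x y) (q : Path y z) :
    curveValue c (p.trans q).toContinuousMap =
      curveValue c p.toContinuousMap + curveValue c q.toContinuousMap :=
  (curveValue_add c (curveChain_trans ℤ p q)).symm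

theorem curveValue_seg_add (c : Cocycles X) (P : C(ℝ, X)) (a b e : ℝ) :
    curveValue c (seg P a b) + curveValue c (seg P b e) = curveValue c (seg P a e) :=
  curveValue_add c (curveChain_seg_add P a b e)

theorem curveValue_const (c : Cocycles X) (x : X) :
    curveValue c (ContinuousMap.const _ x) = 0 := by
  have h := extend_eq_zero c (curveChain_const x)
  rwa [extend_curveChain] at h

theorem eval_loopClass (c : Cocycles X) (p : C(unitInterval, X)) (h : p 0 = p 1) :
    eval ℝ (Submodule.Quotient.mk c) (loopClass ℝ p h) = curveValue c p :=
  extend_curveChain ℝ c p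

theorem eval_diff (c : Cocycles X) {x₀ : X} (p q : PathSpace x₀) (h : p.endpoint = q.endpoint) :
    eval ℤ (Submodule.Quotient.mk c) (p.diff q h) = curveValue c p.1 - curveValue c q.1 := by
  have : eval ℤ (Submodule.Quotient.mk c) (p.diff q h) =
    extend ℤ c.1 (curveChain ℤ p.1 - curveChain ℤ q.1) := rfl
  rw [this, map_sub, extend_curveChain, extend_curveChain]

end cocycles

theorem PathSpace.exists_endpoint {X : Type*} [TopologicalSpace X] [LocallyPathConnectedSpace X]
    [ConnectedSpace X] {x₀ : X} (x : X) : ∃ p : PathSpace x₀, p.endpoint = x := by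
  have : PathConnectedSpace X := pathConnectedSpace_iff_connectedSpace.2 inferInstance
  obtain ⟨p⟩ := PathConnectedSpace.joined x₀ x
  exact ⟨⟨p.toContinuousMap, p.source⟩, p.target⟩

/-! ### Lifting curves and the flow to the coverings -/

namespace Cover

variable {X : Type*} [TopologicalSpace X] {x₀ : X} {K : Submodule ℤ (H1 ℤ X)}

theorem exists_mk (x : Cover x₀ K) : ∃ p : PathSpace x₀, mk K p = x := Quotient.exists_rep x

theorem mk_eq_mk {p q : PathSpace x₀} :
    mk K p = mk K q ↔ ∃ h : p.endpoint = q.endpoint, p.diff q h ∈ K :=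
  Quotient.eq (r := coverSetoid x₀ K)


theorem continuous_mk : Continuous (mk K : PathSpace x₀ → Cover x₀ K) :=
  continuous_quotient_mk' (s := coverSetoid x₀ K)

theorem continuous_proj : Continuous (proj : Cover x₀ K → X) := by
  refine Continuous.quotient_lift (s := coverSetoid x₀ K) ?_ _
  exact (continuous_eval_const (1 : unitInterval)).comp continuous_subtype_val

/-- `y` is the end of the lift starting at `x` of the curve `a`. -/
def Link (x : Cover x₀ K) (a : C(unitInterval, X)) (y : Cover x₀ K) : Prop :=
  ∃ p q : PathSpace x₀, mk K p = x ∧ mk K q = y ∧ p.endpoint = a 0 ∧ q.endpoint = a 1 ∧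
    curveChain ℤ p.1 + curveChain ℤ a - curveChain ℤ q.1 ∈ LinearMap.range (boundary ℤ X 1)

/-- Subtracting the two relations cancels `a`: lifting along a common curve preserves differences of
representatives. -/
theorem diff_eq_diff {p q p' q' : PathSpace x₀} {a : C(unitInterval, X)}
    (h : curveChain ℤ p.1 + curveChain ℤ a - curveChain ℤ q.1 ∈ LinearMap.range (boundary ℤ X 1))
    (h' : curveChain ℤ p'.1 + curveChain ℤ a - curveChain ℤ q'.1
      ∈ LinearMap.range (boundary ℤ X 1)) (e : p.endpoint = p'.endpoint)
    (e' : q.endpoint = q'.endpoint) : q.diff q' e' = p.diff p' e := by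
  refine (Submodule.Quotient.eq _).2 ?_
  change curveChain ℤ q.1 - curveChain ℤ q'.1 - (curveChain ℤ p.1 - curveChain ℤ p'.1)
      ∈ LinearMap.range (boundary ℤ X 1)
  convert Submodule.sub_mem _ h' h using 1
  abel

theorem link_mk_append (p : PathSpace x₀) {y : X} (a : Path p.endpoint y) :
    Link (mk K p) a.toContinuousMap (mk K (p.append a)) :=
  ⟨p, p.append a, rfl, rfl, a.source.symm, by rw [PathSpace.endpoint_append]; exact a.target.symm,
    curveChain_trans ℤ p.toPath a⟩

namespace Link

theorem proj_left {x y : Cover x₀ K} {a : C(unitInterval, X)} (h : Link x a y) :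
    x.proj = a 0 := by
  obtain ⟨p, q, rfl, rfl, h0, -, -⟩ := h
  exact h0

theorem proj_right {x y : Cover x₀ K} {a : C(unitInterval, X)} (h : Link x a y) :
    y.proj = a 1 := by
  obtain ⟨p, q, rfl, rfl, -, h1, -⟩ := h
  exact h1

theorem exists_right (x : Cover x₀ K) (a : C(unitInterval, X)) (h : x.proj = a 0) :
    ∃ y, Link x a y := by
  obtain ⟨p, rfl⟩ := exists_mk x
  exact ⟨_, link_mk_append p (y := a 1) ⟨a, h.symm, rfl⟩⟩

theorem unique {x y y' : Cover x₀ K} {a : C(unitInterval, X)} (h : Link x a y)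
    (h' : Link x a y') : y = y' := by
  obtain ⟨p, q, rfl, rfl, h0, h1, hc⟩ := h
  obtain ⟨p', q', hp, rfl, h0', h1', hc'⟩ := h'
  obtain ⟨e, he⟩ := mk_eq_mk.1 hp.symm
  refine mk_eq_mk.2 ⟨h1.trans h1'.symm, ?_⟩
  rwa [diff_eq_diff hc hc' e]

/-- The same `δ` moves both ends; this is what makes deck-invariant quantities depend only on the
curve in the base. -/
theorem translate {x y x' y' : Cover x₀ K} {a : C(unitInterval, X)} (h : Link x a y)
    (h' : Link x' a y') : ∃ δ, IsTranslate δ x x' ∧ IsTranslate δ y y' := by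
  obtain ⟨p, q, rfl, rfl, h0, h1, hc⟩ := h
  obtain ⟨p', q', rfl, rfl, h0', h1', hc'⟩ := h'
  exact ⟨p'.diff p (h0'.trans h0.symm), ⟨p, p', _, rfl, rfl, rfl⟩,
    ⟨q, q', h1'.trans h1.symm, rfl, rfl, diff_eq_diff hc' hc _ _⟩⟩

/-- The composite `e` is only required to be homologous to `a + b`, so that both `Path.trans` and
affine segments qualify. -/
theorem comp {x y z : Cover x₀ K} {a b e : C(unitInterval, X)} (h : Link x a y)
    (h' : Link y b z) (h0 : e 0 = a 0) (h1 : e 1 = b 1)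
    (he : curveChain ℤ a + curveChain ℤ b - curveChain ℤ e ∈ LinearMap.range (boundary ℤ X 1)) :
    Link x e z := by
  obtain ⟨p, q, rfl, rfl, hp, hq, hc⟩ := h
  -- The representative of `y` used by `h'` may differ from `q`; uniqueness of lifts lets `z` be
  -- represented by `q` followed by `b`.
  have hl := link_mk_append (K := K) q (y := b 1) ⟨b, h'.proj_left.symm, rfl⟩
  have hz := hl.unique h'
  refine ⟨p, _, rfl, hz, hp.trans h0.symm, (PathSpace.endpoint_append _ _).trans h1.symm, ?_⟩
  have h3 := curveChain_trans ℤ q.toPath (⟨b, h'.proj_left.symm, rfl⟩ : Path q.endpoint (b 1))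
  convert Submodule.add_mem _ (Submodule.sub_mem _ hc he) h3 using 1
  change _ = curveChain ℤ p.1 + curveChain ℤ a - curveChain ℤ q.1
    - (curveChain ℤ a + curveChain ℤ b - curveChain ℤ e)
    + (curveChain ℤ q.1 + curveChain ℤ b - curveChain ℤ (PathSpace.append q _).1)
  abel

theorem const (x : Cover x₀ K) : Link x (ContinuousMap.const _ x.proj) x := by
  obtain ⟨p, rfl⟩ := exists_mk x
  refine ⟨p, p, rfl, rfl, rfl, rfl, ?_⟩
  simpa using curveChain_const _

end Link

theorem link_liftFlow (φ : Flow ℝ X) (t : ℝ) (x : Cover x₀ K) :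
    Link x (orbitArc φ t x.proj).toContinuousMap (liftFlow φ t x) := by
  obtain ⟨p, rfl⟩ := exists_mk x
  exact link_mk_append p (orbitArc φ t p.endpoint)

@[simp] theorem proj_liftFlow (φ : Flow ℝ X) (t : ℝ) (x : Cover x₀ K) :
    (liftFlow φ t x).proj = φ t x.proj :=
  (link_liftFlow φ t x).proj_right.trans (orbitArc φ t x.proj).target

/-- The curve `p` followed by the curve `A`. -/
def glue (p : PathSpace x₀) (A : C(ℝ, X)) (h : p.endpoint = A 0) : C(ℝ, X) :=
  ⟨fun s => if s ≤ 1 then p.1 (projIcc 0 1 zero_le_one s) else A (s - 1), by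
    refine Continuous.if_le (by fun_prop) (by fun_prop) continuous_id continuous_const ?_
    rintro s rfl
    have h' : p.1 1 = A 0 := h
    simpa using h'⟩

theorem glue_of_le (p : PathSpace x₀) (A : C(ℝ, X)) (h : p.endpoint = A 0) (t : unitInterval) :
    glue p A h t = p.1 t := by
  change (if (t : ℝ) ≤ 1 then _ else _) = _
  rw [if_pos t.2.2, projIcc_val]

theorem glue_one_add (p : PathSpace x₀) (A : C(ℝ, X)) (h : p.endpoint = A 0) {s : ℝ}
    (hs : 0 ≤ s) : glue p A h (1 + s) = A s := by
  change (if 1 + s ≤ 1 then _ else _) = _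
  rcases hs.eq_or_lt with rfl | hs
  · have h' : p.1 1 = A 0 := h
    simpa using h'
  · rw [if_neg (by linarith), add_sub_cancel_left]

/-- Curves in the base lift to the covering. -/
theorem exists_lift (x : Cover x₀ K) (A : C(ℝ, X)) (h : x.proj = A 0) :
    ∃ B : ℝ → Cover x₀ K, Continuous B ∧ B 0 = x ∧
      ∀ s s', 0 ≤ s → 0 ≤ s' → Link (B s) (seg A s s') (B s') := by
  obtain ⟨p, rfl⟩ := exists_mk x
  set P := glue p A h
  have hP0 : P 0 = x₀ := (glue_of_le p A h 0).trans p.2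
  -- The lift at time `s` is the class of the glued curve restricted to `[0, 1 + s]`. It is
  -- continuous because this restriction is continuous in the compact-open topology.
  let Q : ℝ → PathSpace x₀ := fun s => ⟨seg P 0 s, (seg_zero P 0 s).trans hP0⟩
  have hQ : Continuous Q := by
    refine Continuous.subtype_mk (ContinuousMap.continuous_of_continuous_uncurry
      (fun s => seg P 0 s) ?_) _
    exact P.continuous.comp (by fun_prop : Continuous fun z : ℝ × unitInterval =>
      0 + (z.1 - 0) * (z.2 : ℝ))
  have hend : ∀ s, (Q s).endpoint = P s := fun s => seg_one P 0 s
  refine ⟨fun s => mk K (Q (1 + s)),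
    (continuous_mk (K := K)).comp (hQ.comp (by fun_prop : Continuous fun s : ℝ => 1 + s)),
    ?_, ?_⟩
  · refine congrArg (mk K) (Subtype.ext (ContinuousMap.ext fun t => ?_))
    change P (0 + (1 + 0 - 0) * t) = p.1 t
    rw [← glue_of_le p A h t]
    congr 1
    ring
  · intro s s' hs hs'
    have hseg : seg P (1 + s) (1 + s') = seg A s s' := by
      ext t
      have : 0 ≤ s + (s' - s) * t := by
        have h0 := t.2.1
        have h1 := t.2.2
        nlinarith [mul_nonneg hs (sub_nonneg.2 h1), mul_nonneg hs' h0]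
      simp only [seg_apply]
      rw [← glue_one_add p A h this]
      congr 1
      ring
    refine ⟨Q (1 + s), Q (1 + s'), rfl, rfl, ?_, ?_, ?_⟩
    · rw [hend, seg_zero, glue_one_add p A h hs]
    · rw [hend, seg_one, glue_one_add p A h hs']
    · rw [← hseg]
      exact curveChain_seg_add P 0 (1 + s) (1 + s')

/-- The orbits of the lifted flow are continuous in positive time. -/
theorem exists_lift_orbit (φ : Flow ℝ X) (x : Cover x₀ K) :
    ∃ B : ℝ → Cover x₀ K, Continuous B ∧ ∀ s, 0 ≤ s → B s = liftFlow φ s x := by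
  let A : C(ℝ, X) := ⟨fun s => φ s x.proj, φ.continuous continuous_id continuous_const⟩
  obtain ⟨B, hB, hB0, hl⟩ := exists_lift x A (φ.map_zero_apply _).symm
  refine ⟨B, hB, fun s hs => ?_⟩
  have h := hl 0 s le_rfl hs
  rw [hB0] at h
  refine h.unique ?_
  convert link_liftFlow φ s x using 1
  ext t
  change φ (0 + (s - 0) * t) _ = φ (t * s) _
  congr 1
  ring

theorem liftFlow_zero (φ : Flow ℝ X) (x : Cover x₀ K) : liftFlow φ 0 x = x := by
  refine (link_liftFlow φ 0 x).unique ?_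
  convert Link.const x using 1
  ext t
  change φ (t * 0) _ = x.proj
  rw [mul_zero, φ.map_zero_apply]

/-- Both sides are the end of a lift of the same orbit segment, so uniqueness of lifts applies. -/
theorem liftFlow_add (φ : Flow ℝ X) (s t : ℝ) (x : Cover x₀ K) :
    liftFlow φ (s + t) x = liftFlow φ t (liftFlow φ s x) := by
  let A : C(ℝ, X) := ⟨fun s => φ s x.proj, φ.continuous continuous_id continuous_const⟩
  have e1 : seg A 0 s = (orbitArc φ s x.proj).toContinuousMap := by
    ext u
    change φ (0 + (s - 0) * u) _ = φ (u * s) _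
    congr 1
    ring
  have e2 : seg A s (s + t) = (orbitArc φ t (liftFlow φ s x).proj).toContinuousMap := by
    ext u
    change φ (s + (s + t - s) * u) _ = φ (u * t) _
    rw [proj_liftFlow, ← φ.map_add]
    congr 1
    ring
  have e3 : seg A 0 (s + t) = (orbitArc φ (s + t) x.proj).toContinuousMap := by
    ext u
    change φ (0 + (s + t - 0) * u) _ = φ (u * (s + t)) _
    congr 1
    ring
  refine (link_liftFlow φ (s + t) x).unique ?_
  refine (link_liftFlow φ s x).comp (link_liftFlow φ t _) ?_ ?_ ?_
  · exact (orbitArc φ (s + t) x.proj).source.trans (orbitArc φ s x.proj).source.symm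
  · refine (orbitArc φ (s + t) x.proj).target.trans (Eq.trans ?_
      (orbitArc φ t (liftFlow φ s x).proj).target.symm)
    rw [proj_liftFlow, ← φ.map_add, add_comm]
  · rw [← e1, ← e2, ← e3]
    exact curveChain_seg_add A 0 s (s + t)

/-! ### The primitive of a cocycle and equivariant functions -/

/-- The value of a cocycle on a curve that represents a point of the covering. -/
def primitive (c : Cocycles X) (x : Cover x₀ K) : ℝ := curveValue c (Quotient.out x).1

section primitive

variable {c : Cocycles X}

/-- Two representatives differ by a class of `K`, on which the cocycle vanishes. -/
theorem primitive_mk (hK : K ≤ intKer (Submodule.Quotient.mk c)) (p : PathSpace x₀) :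
    primitive c (mk K p) = curveValue c p.1 := by
  have h : mk K (Quotient.out (mk K p)) = mk K p := Quotient.out_eq _
  obtain ⟨e, he⟩ := mk_eq_mk.1 h
  have h0 : eval ℤ (Submodule.Quotient.mk c) (PathSpace.diff _ _ e) = 0 := hK he
  rw [eval_diff] at h0
  exact sub_eq_zero.1 h0

theorem Link.primitive_eq (hK : K ≤ intKer (Submodule.Quotient.mk c)) {x y : Cover x₀ K}
    {a : C(unitInterval, X)} (h : Link x a y) : primitive c y = primitive c x + curveValue c a := by
  obtain ⟨p, q, rfl, rfl, -, -, hc⟩ := h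
  rw [primitive_mk hK, primitive_mk hK]
  exact (curveValue_add c hc).symm

/-- Any two points of a fibre are translates of each other, by the difference `δ` of representing
curves, and the primitive changes by the value of the cocycle on `δ`. -/
theorem isEquivariant_iff (hK : K ≤ intKer (Submodule.Quotient.mk c)) {f : Cover x₀ K → ℝ} :
    IsEquivariant (Submodule.Quotient.mk c) f ↔
      ∀ x y : Cover x₀ K, x.proj = y.proj → f y - f x = primitive c y - primitive c x := by
  constructor
  · intro hf x y h
    obtain ⟨p, rfl⟩ := exists_mk x
    obtain ⟨q, rfl⟩ := exists_mk y
    have e : q.endpoint = p.endpoint := h.symm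
    have := hf (q.diff p e) _ _ ⟨p, q, e, rfl, rfl, rfl⟩
    rw [this, eval_diff, primitive_mk hK, primitive_mk hK]
    ring
  · rintro hf δ x y ⟨p, q, h, rfl, rfl, rfl⟩
    have := hf (mk K p) (mk K q) h.symm
    rw [eval_diff, ← primitive_mk hK, ← primitive_mk hK (K := K) p]
    linarith

/-- Allows the variation of `f` along a lift to be computed on any other lift of the same curve, in
particular near a chosen reference point. -/
theorem Link.sub_eq_sub (hK : K ≤ intKer (Submodule.Quotient.mk c)) {f : Cover x₀ K → ℝ}
    (hf : IsEquivariant (Submodule.Quotient.mk c) f) {x y x' y' : Cover x₀ K}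
    {a : C(unitInterval, X)} (h : Link x a y) (h' : Link x' a y') : f y - f x = f y' - f x' := by
  have hf' := (isEquivariant_iff hK).1 hf
  have h1 := hf' x x' (h.proj_left.trans h'.proj_left.symm)
  have h2 := hf' y y' (h.proj_right.trans h'.proj_right.symm)
  have h3 := h.primitive_eq hK
  have h4 := h'.primitive_eq hK
  linarith

end primitive

end Cover

/-! ### Lifted metrics and uniform estimates by compactness of the base -/

namespace IsLiftedMetric

open Cover

section basic

variable {M : Type*} [MetricSpace M] {x₀ : M} {K : Submodule ℤ (H1 ℤ M)}
  {d : Cover x₀ K → Cover x₀ K → ℝ}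

theorem self (hd : IsLiftedMetric d) (x : Cover x₀ K) : d x x = 0 := (hd.eq_zero_iff x x).2 rfl

theorem nonneg (hd : IsLiftedMetric d) (x y : Cover x₀ K) : 0 ≤ d x y := by
  have h := hd.triangle x y x
  rw [hd.self, hd.symm y x] at h
  linarith

theorem isOpen_ball (hd : IsLiftedMetric d) (x : Cover x₀ K) (r : ℝ) : IsOpen {y | d x y < r} := by
  refine (hd.isOpen_iff _).2 fun y hy => ⟨r - d x y, sub_pos.2 hy, fun z hz => ?_⟩
  have := hd.triangle x y z
  change d x z < r
  linarith

theorem tendsto_iff (hd : IsLiftedMetric d) {ι : Type*} {l : Filter ι} {u : ι → Cover x₀ K}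
    {y : Cover x₀ K} : Tendsto u l (𝓝 y) ↔ ∀ η > 0, ∀ᶠ i in l, d y (u i) < η := by
  constructor
  · intro h η hη
    exact h ((hd.isOpen_ball y η).mem_nhds (by simpa [hd.self] using hη))
  · intro h
    refine tendsto_nhds.2 fun U hU hy => ?_
    obtain ⟨η, hη, hU'⟩ := (hd.isOpen_iff U).1 hU y hy
    exact (h η hη).mono fun i hi => hU' _ hi

theorem eq_of_forall_lt (hd : IsLiftedMetric d) {x y : Cover x₀ K} (h : ∀ η > 0, d x y < η) :
    x = y := by
  refine (hd.eq_zero_iff x y).1 (le_antisymm ?_ (hd.nonneg x y))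
  exact le_of_forall_pos_lt_add fun η hη => by simpa using h η hη

theorem tendsto_unique (hd : IsLiftedMetric d) {ι : Type*} {l : Filter ι} [l.NeBot]
    {u : ι → Cover x₀ K} {y z : Cover x₀ K} (hy : Tendsto u l (𝓝 y)) (hz : Tendsto u l (𝓝 z)) :
    y = z := by
  refine hd.eq_of_forall_lt fun η hη => ?_
  obtain ⟨i, h1, h2⟩ := ((hd.tendsto_iff.1 hy _ (half_pos hη)).and
    (hd.tendsto_iff.1 hz _ (half_pos hη))).exists
  have := hd.triangle y (u i) z
  rw [hd.symm (u i) z] at this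
  linarith

theorem dist_eq_of_link (hd : IsLiftedMetric d) {x y x' y' : Cover x₀ K}
    {a : C(unitInterval, M)} (h : Link x a y) (h' : Link x' a y') : d x' y' = d x y := by
  obtain ⟨δ, h1, h2⟩ := h.translate h'
  exact hd.deck_invariant δ x y x' y' h1 h2

/-- Balls of `d` are open for the quotient topology, so their preimages are open in the path space.
The comparison is with `p` followed by a constant curve, which has the same first half as `p.append
a` and represents the same point as `p`. -/
theorem exists_append_lt (hd : IsLiftedMetric d) (p : PathSpace x₀) {r : ℝ} (hr : 0 < r) :
    ∃ η > 0, ∀ (y : M) (a : Path p.endpoint y), (∀ t, a t ∈ Metric.ball p.endpoint η) →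
      d (Cover.mk K p) (Cover.mk K (p.append a)) < r := by
  have hopen := (hd.isOpen_ball (Cover.mk K p) r).preimage (Cover.continuous_mk (K := K))
  have hmem : p.append (Path.refl p.endpoint) ∈ Cover.mk K ⁻¹' {y | d (Cover.mk K p) y < r} := by
    have h : Cover.mk K (p.append (Path.refl p.endpoint)) = Cover.mk K p :=
      (link_mk_append p (Path.refl p.endpoint)).unique (Link.const (Cover.mk K p))
    change d (Cover.mk K p) _ < r
    rwa [h, hd.self]
  obtain ⟨η, hη, h⟩ := Metric.isOpen_iff.1 hopen _ hmem
  refine ⟨η, hη, fun y a ha => h ?_⟩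
  rw [Metric.mem_ball, Subtype.dist_eq]
  refine (ContinuousMap.dist_lt_iff hη).2 fun t => ?_
  change dist ((p.toPath.trans a) t) ((p.toPath.trans (Path.refl _)) t) < η
  rw [Path.trans_apply, Path.trans_apply]
  split_ifs with h
  · simpa using hη
  · exact ha _

end basic

section compact

variable {M : Type*} [MetricSpace M] [CompactSpace M] [LocallyPathConnectedSpace M]
  [ConnectedSpace M] {x₀ : M} {K : Submodule ℤ (H1 ℤ M)} {d : Cover x₀ K → Cover x₀ K → ℝ}

/-- The lifts of small curves are small. -/
theorem exists_forall_link_lt (hd : IsLiftedMetric d) {r : ℝ} (hr : 0 < r) :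
    ∃ ε > 0, ∀ (z : M) (a : C(unitInterval, M)) (x y : Cover x₀ K),
      (∀ t, a t ∈ Metric.ball z ε) → Link x a y → d x y < r := by
  choose p hp using PathSpace.exists_endpoint (X := M) (x₀ := x₀)
  choose η hη h using fun z => hd.exists_append_lt (p z) (half_pos hr)
  choose ρ hρ hj using fun z : M => exists_joinedIn_ball z (hη z)
  obtain ⟨ε, hε, hL⟩ := lebesgue_number_lemma_of_metric (isCompact_univ (X := M))
    (c := fun x => Metric.ball x (min (ρ x) (η x))) (fun _ => Metric.isOpen_ball)
    fun z _ => mem_iUnion.2 ⟨z, Metric.mem_ball_self (lt_min (hρ z) (hη z))⟩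
  refine ⟨ε, hε, fun z₀ a x y ha hl => ?_⟩
  obtain ⟨z, hz⟩ := hL z₀ (mem_univ z₀)
  -- From the reference lift over `z`, the lifts of `b` and of `b` followed by `a` both end within
  -- `r / 2`. Hence this lift of `a` has ends closer than `r`, and deck invariance transfers the
  -- bound to every lift.
  obtain ⟨b, hb⟩ := hj z (a 0) (Metric.ball_subset_ball (min_le_left _ _) (hz (ha 0)))
  have ha' : ∀ t, a t ∈ Metric.ball z (η z) := fun t =>
    Metric.ball_subset_ball (min_le_right _ _) (hz (ha t))
  have hpz := hp z
  have hball : Metric.ball (p z).endpoint (η z) = Metric.ball z (η z) := by rw [hpz]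
  let a' : Path (a 0) (a 1) := ⟨a, rfl, rfl⟩
  let b' : Path (p z).endpoint (a 0) := b.cast hpz rfl
  have h1 := h z _ b' (fun t => hball.symm ▸ hb t)
  have h2 := h z _ (b'.trans a') (fun t => by
    rw [hball, Path.trans_apply]
    split_ifs
    · exact hb _
    · exact ha' _)
  have l1 := link_mk_append (K := K) (p z) b'
  have l2 := link_mk_append (K := K) (p z) (b'.trans a')
  have e1 : (Cover.mk K ((p z).append b')).proj = a 0 := PathSpace.endpoint_append _ _
  obtain ⟨y', hy'⟩ := Link.exists_right _ a e1
  have e2 : Cover.mk K ((p z).append (b'.trans a')) = y' := by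
    refine l2.unique (l1.comp hy' ?_ ?_ (curveChain_trans ℤ b' a'))
    · exact (b'.trans a').source.trans b'.source.symm
    · exact (b'.trans a').target
  rw [e2] at h2
  rw [hd.dist_eq_of_link hy' hl]
  have := hd.triangle (Cover.mk K ((p z).append b')) (Cover.mk K (p z)) y'
  rw [hd.symm _ (Cover.mk K (p z))] at this
  linarith

/-- Nearby points of the covering are joined by the lift of a small curve. -/
theorem exists_forall_exists_link (hd : IsLiftedMetric d) {η : ℝ} (hη : 0 < η) :
    ∃ ε > 0, ∀ x y : Cover x₀ K, d x y < ε → ∃ a : C(unitInterval, M), Link x a y ∧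
      (∀ t, a t ∈ Metric.ball x.proj η) ∧ (x.proj = y.proj → ∀ t, a t = x.proj) := by
  obtain ⟨r, hr, hiso⟩ := hd.isometry_on_balls
  obtain ⟨ε₁, hε₁, h1⟩ := hd.exists_forall_link_lt hr
  obtain ⟨ε₂, hε₂, h2⟩ := exists_forall_joinedIn_ball (M := M) (lt_min hη hε₁)
  have hself : ∀ x, d x x < r := fun x => by rwa [hd.self]
  refine ⟨min r ε₂, lt_min hr hε₂, fun x y hxy => ?_⟩
  have hxy1 := hxy.trans_le (min_le_left _ _)
  have hxy2 := hxy.trans_le (min_le_right _ _)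
  have hdist := hiso x x y (hself x) hxy1
  -- A constant curve is needed here: where a periodic pseudo-orbit has no jump, its realization may
  -- not leave the point.
  by_cases hp : x.proj = y.proj
  · have : x = y := by
      rw [hp, dist_self] at hdist
      exact (hd.eq_zero_iff x y).1 hdist.symm
    subst this
    exact ⟨_, Link.const x, fun t => Metric.mem_ball_self hη, fun _ _ => rfl⟩
  · obtain ⟨a, ha⟩ := h2 x.proj y.proj (by rwa [hdist])
    -- The lift of the short curve ends at `y'`, over the same point as `y`. Both lie within `r` of
    -- `x`, where the projection is isometric, so they coincide.
    obtain ⟨y', hy'⟩ := Link.exists_right x a.toContinuousMap a.source.symm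
    have h3 := h1 x.proj a.toContinuousMap x y'
      (fun t => Metric.ball_subset_ball (min_le_right _ _) (ha t)) hy'
    have hpy : y'.proj = y.proj := hy'.proj_right.trans a.target
    have h4 := hiso x y' y h3 hxy1
    rw [hpy, dist_self] at h4
    rw [(hd.eq_zero_iff y' y).1 h4.symm] at hy'
    exact ⟨a.toContinuousMap, hy', fun t => Metric.ball_subset_ball (min_le_left _ _) (ha t),
      fun h => absurd h hp⟩

variable {c : Cocycles M}

/-- A continuous equivariant function has small variation at a small scale. -/
theorem exists_forall_le_add_one (hd : IsLiftedMetric d)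
    (hK : K ≤ intKer (Submodule.Quotient.mk c)) {f : Cover x₀ K → ℝ} (hfc : Continuous f)
    (hf : IsEquivariant (Submodule.Quotient.mk c) f) :
    ∃ ρ > 0, ∀ x y : Cover x₀ K, d x y < ρ → f y ≤ f x + 1 := by
  choose p hp using PathSpace.exists_endpoint (X := M) (x₀ := x₀)
  have hcont : ∀ z : M, ∃ η > 0, ∀ y, d (Cover.mk K (p z)) y < η → |f y - f (Cover.mk K (p z))| < 1 / 2 := by
    intro z
    have hopen : IsOpen {y | |f y - f (Cover.mk K (p z))| < 1 / 2} :=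
      isOpen_lt (by fun_prop) continuous_const
    exact (hd.isOpen_iff _).1 hopen _ (by simp)
  choose η hη h using hcont
  choose ε hε hb using fun z => hd.exists_forall_link_lt (half_pos (hη z))
  choose ρ hρ hj using fun z : M => exists_joinedIn_ball z (hε z)
  obtain ⟨ε', hε', hL⟩ := lebesgue_number_lemma_of_metric (isCompact_univ (X := M))
    (c := fun x => Metric.ball x (min (ρ x) (ε x))) (fun _ => Metric.isOpen_ball)
    fun z _ => mem_iUnion.2 ⟨z, Metric.mem_ball_self (lt_min (hρ z) (hε z))⟩
  obtain ⟨ε'', hε'', hlink⟩ := hd.exists_forall_exists_link hε'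
  refine ⟨ε'', hε'', fun x y hxy => ?_⟩
  obtain ⟨a, hl, ha, -⟩ := hlink x y hxy
  obtain ⟨z, hz⟩ := hL x.proj (mem_univ _)
  -- The pair `x`, `y` is transported near the reference lift over `z`, where `f` is within `1 / 2`
  -- of its reference value by continuity at one point.
  obtain ⟨b, hbz⟩ := hj z x.proj
    (Metric.ball_subset_ball (min_le_left _ _) (hz (Metric.mem_ball_self hε')))
  have e0 : (Cover.mk K (p z)).proj = b 0 := (hp z).trans b.source.symm
  obtain ⟨x', hx'⟩ := Link.exists_right _ b.toContinuousMap e0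
  have e1 : x'.proj = a 0 := by
    rw [← hl.proj_left]
    exact hx'.proj_right.trans b.target
  obtain ⟨y', hy'⟩ := Link.exists_right _ a e1
  have d1 := hb z z _ _ _ hbz hx'
  have d2 := hb z z a x' y' (fun t => Metric.ball_subset_ball (min_le_right _ _) (hz (ha t))) hy'
  have d3 := hd.triangle (Cover.mk K (p z)) x' y'
  have f1 := abs_lt.1 (h z x' (by linarith [hη z]))
  have f2 := abs_lt.1 (h z y' (by linarith))
  have := hl.sub_eq_sub hK hf hy'
  linarith [f1.1, f2.2]

/-- The variation of a continuous equivariant function along orbits is bounded in bounded time. -/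
theorem exists_forall_liftFlow_le (hd : IsLiftedMetric d)
    (hK : K ≤ intKer (Submodule.Quotient.mk c)) {f : Cover x₀ K → ℝ} (hfc : Continuous f)
    (hf : IsEquivariant (Submodule.Quotient.mk c) f) (φ : Flow ℝ M) (S : ℝ) :
    ∃ C ≥ 0, ∀ x : Cover x₀ K, ∀ s, 0 ≤ s → s ≤ S → f (liftFlow φ s x) ≤ f x + C := by
  obtain ⟨ρ, hρ, h1⟩ := hd.exists_forall_le_add_one hK hfc hf
  obtain ⟨ε, hε, h2⟩ := hd.exists_forall_link_lt hρ
  -- By compactness, one positive time works for all points: before it, no orbit leaves the `ε`-ball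
  -- of its origin.
  have hev : ∀ᶠ s in 𝓝 (0 : ℝ), ∀ m ∈ (univ : Set M), φ s m ∈ Metric.ball m ε := by
    refine isCompact_univ.eventually_forall_of_forall_eventually fun m _ => ?_
    have hc : Continuous fun z : ℝ × M => dist (φ z.1 z.2) z.2 :=
      (φ.continuous continuous_fst continuous_snd).dist continuous_snd
    refine (hc.tendsto (0, m)).eventually (gt_mem_nhds ?_)
    simpa [φ.map_zero_apply] using hε
  obtain ⟨κ, hκ, hφ⟩ := Metric.eventually_nhds_iff.1 hev
  have hstep : ∀ x : Cover x₀ K, ∀ s, 0 ≤ s → s < κ → f (liftFlow φ s x) ≤ f x + 1 := by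
    intro x s hs hsκ
    refine h1 _ _ (h2 x.proj _ _ _ (fun t => ?_) (link_liftFlow φ s x))
    refine hφ ?_ _ (mem_univ _)
    rw [dist_zero_right, Real.norm_eq_abs, abs_of_nonneg (mul_nonneg t.2.1 hs)]
    exact (mul_le_of_le_one_left hs t.2.2).trans_lt hsκ
  have hn : ∀ n : ℕ, ∀ x : Cover x₀ K, ∀ s, 0 ≤ s → s ≤ n * (κ / 2) →
      f (liftFlow φ s x) ≤ f x + n := by
    intro n
    induction n with
    | zero =>
      intro x s hs hs'
      have : s = 0 := le_antisymm (by simpa using hs') hs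
      simp [this, liftFlow_zero]
    | succ n ih =>
      intro x s hs hs'
      push_cast at hs' ⊢
      rcases le_total s (n * (κ / 2)) with h | h
      · linarith [ih x s hs h]
      · have e : s = n * (κ / 2) + (s - n * (κ / 2)) := by ring
        rw [e, liftFlow_add]
        have h3 := ih x (n * (κ / 2)) (by positivity) le_rfl
        have h4 := hstep (liftFlow φ (n * (κ / 2)) x) (s - n * (κ / 2)) (by linarith) (by linarith)
        linarith
  obtain ⟨n, hn'⟩ := exists_nat_ge (S / (κ / 2))
  refine ⟨n, n.cast_nonneg, fun x s hs hs' => hn n x s hs (hs'.trans ?_)⟩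
  rwa [div_le_iff₀ (half_pos hκ)] at hn'

/-- There is a continuous equivariant function. -/
theorem exists_equivariant (hd : IsLiftedMetric d)
    (hK : K ≤ intKer (Submodule.Quotient.mk c)) :
    ∃ f : Cover x₀ K → ℝ, Continuous f ∧ IsEquivariant (Submodule.Quotient.mk c) f := by
  obtain ⟨r, hr, hiso⟩ := hd.isometry_on_balls
  have hr2 := half_pos hr
  obtain ⟨ε, hε, hlink⟩ := hd.exists_forall_link_lt hr2
  obtain ⟨ρ, hρ, hj⟩ := exists_forall_joinedIn_ball (M := M) hε
  have hinj : ∀ x y z : Cover x₀ K, d x y < r → d x z < r → y.proj = z.proj → y = z := by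
    intro x y z h1 h2 h
    refine (hd.eq_zero_iff y z).1 ?_
    rw [← hiso x y z h1 h2, h, dist_self]
  -- the points over `z` near `x`, and their independence of the choice of the lift
  have hnear : ∀ (z : M) (x : Cover x₀ K), ∃ y : Cover x₀ K, dist x.proj z < ρ →
      d x y < r / 2 ∧ y.proj = z := by
    intro z x
    by_cases h : dist x.proj z < ρ
    · obtain ⟨a, ha⟩ := hj _ _ h
      obtain ⟨y, hy⟩ := Link.exists_right x a.toContinuousMap a.source.symm
      exact ⟨y, fun _ => ⟨hlink _ _ _ _ ha hy, hy.proj_right.trans a.target⟩⟩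
    · exact ⟨x, fun h' => absurd h' h⟩
  choose N hN using hnear
  -- The nearby lift of `z` follows `x` along its fibre, since it is the end of the lift of one
  -- fixed short curve.
  have hNeq : ∀ z (x x' : Cover x₀ K), x.proj = x'.proj → dist x.proj z < ρ →
      primitive c (N z x') - primitive c (N z x) = primitive c x' - primitive c x := by
    intro z x x' h hz
    obtain ⟨a, ha⟩ := hj _ _ hz
    have key : ∀ u : Cover x₀ K, u.proj = x.proj →
        primitive c (N z u) = primitive c u + curveValue c a.toContinuousMap := by
      intro u hu
      obtain ⟨y, hy⟩ := Link.exists_right u a.toContinuousMap (hu.trans a.source.symm)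
      obtain ⟨h1, h2⟩ := hN z u (by rwa [hu])
      have : N z u = y := hinj u _ _ (by linarith) ((hlink _ _ _ _ ha hy).trans (by linarith))
        (h2.trans (hy.proj_right.trans a.target).symm)
      rw [this]
      exact hy.primitive_eq hK
    rw [key x' h.symm, key x rfl]
    ring
  have hNloc : ∀ z (x : Cover x₀ K), dist x.proj z < ρ →
      ∀ᶠ x' in 𝓝 x, N z x' = N z x := by
    intro z x hz
    have h1 : ∀ᶠ x' in 𝓝 x, d x x' < r / 2 :=
      (hd.isOpen_ball x (r / 2)).mem_nhds (by simpa [hd.self] using hr2)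
    have h2 : ∀ᶠ x' : Cover x₀ K in 𝓝 x, dist x'.proj z < ρ :=
      ((continuous_proj.dist continuous_const).tendsto x).eventually (gt_mem_nhds hz)
    filter_upwards [h1, h2] with x' h1 h2
    obtain ⟨h3, h4⟩ := hN z x' h2
    obtain ⟨h5, h6⟩ := hN z x hz
    refine hinj x _ _ ?_ (by linarith) (h4.trans h6.symm)
    have := hd.triangle x x' (N z x')
    linarith
  obtain ⟨Z, hZ⟩ : ∃ Z : Finset M, ∀ x : M, ∃ z ∈ Z, dist x z < ρ / 2 := by
    obtain ⟨Z, -, hZf, hZ⟩ := finite_cover_balls_of_compact (isCompact_univ (X := M)) (half_pos hρ)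
    refine ⟨hZf.toFinset, fun x => ?_⟩
    obtain ⟨z, hz, hx⟩ := mem_iUnion₂.1 (hZ (mem_univ x))
    exact ⟨z, hZf.mem_toFinset.2 hz, hx⟩
  -- The weights vanish beyond `ρ / 2` while `N z` is controlled up to `ρ`: wherever `N z` is
  -- uncontrolled, its weight is zero on a neighbourhood.
  let w : M → M → ℝ := fun z x => max 0 (ρ / 2 - dist x z)
  have hw : ∀ z, Continuous (w z) := fun z => by fun_prop
  let W : M → ℝ := fun x => ∑ z ∈ Z, w z x
  have hWpos : ∀ x, 0 < W x := by
    intro x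
    obtain ⟨z, hz, hx⟩ := hZ x
    refine Finset.sum_pos' (fun _ _ => le_max_left _ _) ⟨z, hz, ?_⟩
    exact lt_max_of_lt_right (sub_pos.2 hx)
  have hWc : Continuous W := continuous_finsetSum _ fun z _ => hw z
  -- The primitive itself need not be continuous, as the singular cocycle is arbitrary. Where the
  -- weight of `z` is positive, its value at the nearby lift of `z` is locally constant in `x` and
  -- has the right change along fibres; the average keeps both continuity and equivariance.
  refine ⟨fun x => (∑ z ∈ Z, w z x.proj * primitive c (N z x)) / W x.proj, ?_, ?_⟩
  · refine Continuous.div ?_ (hWc.comp continuous_proj) fun x => (hWpos _).ne'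
    refine continuous_finsetSum _ fun z _ => continuous_iff_continuousAt.2 fun x => ?_
    by_cases hx : dist x.proj z < ρ
    · refine ContinuousAt.mul ((hw z).comp continuous_proj).continuousAt ?_
      refine (continuousAt_const (y := primitive c (N z x))).congr ?_
      exact (hNloc z x hx).mono fun x' h => congrArg (primitive c) h.symm
    · have h1 : ∀ᶠ x' : Cover x₀ K in 𝓝 x, ρ / 2 < dist x'.proj z :=
        ((continuous_proj.dist continuous_const).tendsto x).eventually
          (lt_mem_nhds (by linarith))
      refine (continuousAt_const (y := (0 : ℝ))).congr ?_
      filter_upwards [h1] with x' h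
      simp only [w]
      rw [max_eq_left (by linarith), zero_mul]
  · refine (isEquivariant_iff hK).2 fun x y h => ?_
    simp only [← h]
    rw [← sub_div, ← Finset.sum_sub_distrib, div_eq_iff (hWpos _).ne', Finset.mul_sum]
    refine Finset.sum_congr rfl fun z _ => ?_
    by_cases hx : dist x.proj z < ρ
    · rw [← mul_sub, hNeq z x y h hx]
      ring
    · have : w z x.proj = 0 := max_eq_left (by linarith)
      rw [this]
      ring

end compact

end IsLiftedMetric

/-! ### Periodic pseudo-orbits built from closed chains of orbit arcs -/

/-- A continuous curve that locally follows a semiflow in positive time follows it. -/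
theorem eq_flow_of_eventually_eq {N : Type*} [TopologicalSpace N] [T2Space N] {ψ : ℝ → N → N}
    (hadd : ∀ s t x, ψ (s + t) x = ψ t (ψ s x)) (h0 : ∀ x, ψ 0 x = x)
    (hc : ∀ x, ContinuousOn (fun t => ψ t x) (Ici 0)) {γ : ℝ → N} {a b : ℝ} (hab : a ≤ b)
    (hloc : ∀ t ∈ Ico a b, ∀ᶠ s in 𝓝[>] t, γ s = ψ (s - t) (γ t))
    (hγ : ContinuousOn γ (Icc a b)) : γ b = ψ (b - a) (γ a) := by
  have hψ : ContinuousOn (fun t => ψ (t - a) (γ a)) (Icc a b) :=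
    (hc (γ a)).comp (by fun_prop : Continuous fun t : ℝ => t - a).continuousOn
      fun t ht => sub_nonneg.2 ht.1
  have hclosed := (hγ.prodMk hψ).preimage_isClosed_of_isClosed isClosed_Icc
    (isClosed_diagonal (X := N))
  have hsub : Icc a b ⊆ {t | γ t = ψ (t - a) (γ a)} := by
    -- Continuous induction: the set of agreement is closed, contains `a`, and extends to the right
    -- of each of its points.
    refine IsClosed.Icc_subset_of_forall_mem_nhdsWithin ?_ ?_ ?_
    · rw [inter_comm]
      exact hclosed
    · simp [h0]
    · rintro t ⟨ht, ht'⟩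
      filter_upwards [hloc t ht'] with s hs
      rw [hs, show γ t = ψ (t - a) (γ a) from ht, ← hadd]
      congr 1
      ring
  exact hsub (right_mem_Icc.2 hab)

/-- A bounded set of reals whose points are distant by at least `T > 0` is finite. -/
theorem finite_of_spacing {S : Set ℝ} {a b T : ℝ} (hT : 0 < T) (hS : S ⊆ Icc a b)
    (h : ∀ u ∈ S, ∀ v ∈ S, u < v → T ≤ v - u) : S.Finite := by
  refine Finite.of_finite_image (f := fun u => ⌊u / T⌋)
    ((finite_Icc ⌊a / T⌋ ⌊b / T⌋).subset ?_) ?_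
  · rintro _ ⟨u, hu, rfl⟩
    exact ⟨Int.floor_le_floor (div_le_div_of_nonneg_right (hS hu).1 hT.le),
      Int.floor_le_floor (div_le_div_of_nonneg_right (hS hu).2 hT.le)⟩
  · have key : ∀ u ∈ S, ∀ v ∈ S, u < v → ⌊u / T⌋ ≠ ⌊v / T⌋ := by
      intro u hu v hv huv he
      have h1 := h u hu v hv huv
      have h2 := Int.abs_sub_lt_one_of_floor_eq_floor he
      rw [abs_sub_comm, ← sub_div, abs_of_pos (by positivity [sub_pos.2 huv]),
        div_lt_one hT] at h2
      linarith
    intro u hu v hv he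
    by_contra hne
    rcases lt_or_gt_of_ne hne with h' | h'
    · exact key u hu v hv h' he
    · exact key v hv u hu h' he.symm

theorem monotone_trans {a b e : ℝ} {p : Path a b} {q : Path b e} (hp : Monotone p)
    (hq : Monotone q) : Monotone (p.trans q) := by
  intro s t hst
  have hst' : (s : ℝ) ≤ t := hst
  rw [Path.trans_apply, Path.trans_apply]
  split_ifs with h1 h2 h2
  · exact hp (Subtype.mk_le_mk.2 (by linarith))
  · calc p _ ≤ p 1 := hp unitInterval.le_one'
      _ = q 0 := by rw [p.target, q.source]
      _ ≤ _ := hq unitInterval.nonneg'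
  · linarith
  · exact hq (Subtype.mk_le_mk.2 (by linarith))

section

variable {M : Type*} [MetricSpace M]

/-- The pairs `(t, y)` through which an `ε`-realization of `γ` may pass. -/
def realizationSet (ε : ℝ) (γ : ℝ → M) : Set (ℝ × M) :=
  {z | (ContinuousAt γ z.1 → z.2 = γ z.1) ∧ (¬ ContinuousAt γ z.1 → z.2 ∈ Metric.ball (γ z.1) ε)}

/-- A closed chain of orbit arcs gives a periodic function that follows these arcs. -/
theorem exists_piecewise_orbit (φ : Flow ℝ M) {T : ℝ} (hT : 0 < T) {n : ℕ} (hn : 0 < n)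
    (x : ℕ → M) (l : ℕ → ℝ) (hl : ∀ k, T ≤ l k) :
    ∃ γ : ℝ → M, ∀ (m : ℤ) (k : ℕ) (s : ℝ), k < n → 0 ≤ s → s < l k →
      γ (m * ∑ j ∈ Finset.range n, l j + ∑ j ∈ Finset.range k, l j + s) = φ s (x k) := by
  have hlpos : ∀ k, 0 < l k := fun k => hT.trans_le (hl k)
  set t : ℕ → ℝ := fun k => ∑ j ∈ Finset.range k, l j with ht
  have hts : ∀ k, t (k + 1) = t k + l k := fun k => Finset.sum_range_succ _ _
  have ht0 : t 0 = 0 := Finset.sum_range_zero _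
  have hmono : StrictMono t := strictMono_nat_of_lt_succ fun k => by
    rw [hts]; linarith [hlpos k]
  have hL : 0 < t n := ht0 ▸ hmono hn
  have hex : ∀ r : ℝ, ∃ y : M, ∀ (m : ℤ) (k : ℕ) (s : ℝ), k < n → 0 ≤ s → s < l k →
      r = m * t n + t k + s → y = φ s (x k) := by
    intro r
    by_cases h : ∃ (m : ℤ) (k : ℕ) (s : ℝ), k < n ∧ 0 ≤ s ∧ s < l k ∧ r = m * t n + t k + s
    · obtain ⟨m, k, s, hk, hs0, hs, hr⟩ := h
      refine ⟨φ s (x k), fun m' k' s' hk' hs0' hs' hr' => ?_⟩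
      -- The prescription is consistent because a time determines its period, its arc and its
      -- position on the arc.
      have key : ∀ (m : ℤ) (k : ℕ) (s : ℝ), k < n → 0 ≤ s → s < l k → r = m * t n + t k + s →
          m = ⌊r / t n⌋ := by
        intro m k s hk hs0 hs hr
        refine (Int.floor_eq_iff.2 ⟨?_, ?_⟩).symm
        · rw [le_div_iff₀ hL, hr]
          have : 0 ≤ t k := ht0 ▸ hmono.monotone (Nat.zero_le k)
          linarith
        · rw [div_lt_iff₀ hL, hr]
          have : t (k + 1) ≤ t n := hmono.monotone hk
          rw [hts] at this
          linarith
      have hm : m = m' := (key m k s hk hs0 hs hr).trans (key m' k' s' hk' hs0' hs' hr').symm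
      subst hm
      have h1 : t k + s = t k' + s' := by linarith
      have hkk : k = k' := by
        refine le_antisymm ?_ ?_
        · refine Nat.lt_succ_iff.1 (hmono.lt_iff_lt.1 ?_)
          rw [hts]
          linarith
        · refine Nat.lt_succ_iff.1 (hmono.lt_iff_lt.1 ?_)
          rw [hts]
          linarith
      subst hkk
      rw [show s = s' by linarith]
    · exact ⟨x 0, fun m k s h1 h2 h3 h4 => absurd ⟨m, k, s, h1, h2, h3, h4⟩ h⟩
  choose γ hγ using hex
  exact ⟨γ, fun m k s hk hs0 hs => hγ _ m k s hk hs0 hs rfl⟩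

theorem exists_index {l : ℕ → ℝ} (n : ℕ) (r : ℝ) (h0 : 0 ≤ r)
    (hr : r < ∑ j ∈ Finset.range n, l j) :
    ∃ (k : ℕ) (s : ℝ), k < n ∧ 0 ≤ s ∧ s < l k ∧ r = ∑ j ∈ Finset.range k, l j + s := by
  induction n with
  | zero =>
    rw [Finset.sum_range_zero] at hr
    linarith
  | succ n ih =>
    rcases lt_or_ge r (∑ j ∈ Finset.range n, l j) with h | h
    · obtain ⟨k, s, hk, h'⟩ := ih h
      exact ⟨k, s, hk.trans n.lt_succ_self, h'⟩
    · rw [Finset.sum_range_succ] at hr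
      exact ⟨n, r - ∑ j ∈ Finset.range n, l j, n.lt_succ_self, by linarith, by linarith, by ring⟩

/-- A closed chain of orbit arcs and of small curves is a realization of a periodic
pseudo-orbit. -/
theorem exists_periodicPseudoOrbit (φ : Flow ℝ M) {T ε : ℝ} (hT : 0 < T) (c : Cocycles M) {n : ℕ}
    (hn : 0 < n) (x : ℕ → M) (l : ℕ → ℝ) (hl : ∀ k, T ≤ l k) (hx : x n = x 0)
    (b : ℕ → C(unitInterval, M)) (hb0 : ∀ k < n, b k 0 = φ (l k) (x k))
    (hb1 : ∀ k < n, b k 1 = x (k + 1)) (hb : ∀ k < n, ∀ t, b k t ∈ Metric.ball (x (k + 1)) ε)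
    (hbc : ∀ k < n, φ (l k) (x k) = x (k + 1) → ∀ t, b k t = x (k + 1)) :
    ∃ (L : ℝ) (γ : ℝ → M) (Γ : C(unitInterval, M)), IsPeriodicPseudoOrbit φ ε T L γ ∧
      IsRealization ε L γ Γ ∧ curveValue c Γ = ∑ k ∈ Finset.range n,
        (curveValue c (orbitArc φ (l k) (x k)).toContinuousMap + curveValue c (b k)) := by
  obtain ⟨γ, hγ⟩ := exists_piecewise_orbit φ hT hn x l hl
  have hlpos : ∀ k, 0 < l k := fun k => hT.trans_le (hl k)
  set t : ℕ → ℝ := fun k => ∑ j ∈ Finset.range k, l j with ht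
  have hts : ∀ k, t (k + 1) = t k + l k := fun k => Finset.sum_range_succ _ _
  have ht0 : t 0 = 0 := Finset.sum_range_zero _
  set L := t n with hLdef
  replace hγ : ∀ (m : ℤ) (k : ℕ) (s : ℝ), k < n → 0 ≤ s → s < l k →
      γ (m * L + t k + s) = φ s (x k) := hγ
  have hL : 0 < L := by
    rw [hLdef, ← Nat.succ_pred_eq_of_pos hn, Nat.succ_eq_add_one, hts]
    have : 0 ≤ t n.pred := Finset.sum_nonneg fun j _ => (hlpos j).le
    linarith [hlpos n.pred]
  have hε : 0 < ε := Metric.pos_of_mem_ball (hb 0 hn 0)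
  have hpiece : ∀ r : ℝ, ∃ (m : ℤ) (k : ℕ) (s : ℝ), k < n ∧ 0 ≤ s ∧ s < l k ∧
      r = m * L + t k + s := by
    intro r
    obtain ⟨k, s, hk, hs0, hs, h⟩ := exists_index (l := l) n (r - ⌊r / L⌋ * L)
      (sub_nonneg.2 ((le_div_iff₀ hL).1 (Int.floor_le _))) (by
        have := (div_lt_iff₀ hL).1 (Int.lt_floor_add_one (r / L))
        change _ < L
        linarith)
    refine ⟨⌊r / L⌋, k, s, hk, hs0, hs, ?_⟩
    change _ = t k + s at h
    linarith
  have hmark : ∀ (m : ℤ) (k : ℕ), k ≤ n → γ (m * L + t k) = x k := by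
    intro m k hk
    rcases hk.eq_or_lt with rfl | hk
    · have := hγ (m + 1) 0 0 hn le_rfl (hlpos 0)
      rw [φ.map_zero_apply, ht0] at this
      rw [hx, ← this]
      congr 1
      push_cast
      ring
    · have := hγ m k 0 hk le_rfl (hlpos k)
      rwa [φ.map_zero_apply, add_zero] at this
  have hnear : ∀ (m : ℤ) (k : ℕ) (r : ℝ), k < n → m * L + t k ≤ r → r < m * L + t k + l k →
      γ r = φ (r - (m * L + t k)) (x k) := by
    intro m k r hk h1 h2
    rw [← hγ m k _ hk (sub_nonneg.2 h1) (by linarith)]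
    congr 1
    ring
  have hφc : ∀ (u : ℝ) (y : M), Continuous fun r => φ (r - u) y := fun u y =>
    φ.continuous (by fun_prop) continuous_const
  have hint : ∀ (m : ℤ) (k : ℕ) (r : ℝ), k < n → m * L + t k < r → r < m * L + t k + l k →
      ContinuousAt γ r := by
    intro m k r hk h1 h2
    refine ((hφc (m * L + t k) (x k)).continuousAt (x := r)).congr ?_
    filter_upwards [Ioo_mem_nhds h1 h2] with r' hr'
    exact (hnear m k r' hk hr'.1.le hr'.2).symm
  have hleft : ∀ (m : ℤ) (k : ℕ), k < n →
      Tendsto γ (𝓝[<] (m * L + t (k + 1))) (𝓝 (φ (l k) (x k))) := by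
    intro m k hk
    have h1 : Tendsto (fun r => φ (r - (m * L + t k)) (x k)) (𝓝[<] (m * L + t (k + 1)))
        (𝓝 (φ (l k) (x k))) := by
      have := ((hφc (m * L + t k) (x k)).tendsto (m * L + t (k + 1))).mono_left
        (nhdsWithin_le_nhds (s := Iio (m * L + t (k + 1))))
      rwa [hts, show m * L + (t k + l k) - (m * L + t k) = l k by ring, ← hts] at this
    refine h1.congr' ?_
    have h2 : m * L + t k < m * L + t (k + 1) := by rw [hts]; linarith [hlpos k]
    filter_upwards [Ioo_mem_nhdsLT h2] with r hr
    exact (hnear m k r hk hr.1.le (by linarith [hr.2, hts k])).symm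
  have hdisc : ∀ r, ¬ ContinuousAt γ r → ∃ (m : ℤ) (k : ℕ), k < n ∧ r = m * L + t k := by
    intro r hr
    obtain ⟨m, k, s, hk, hs0, hs, rfl⟩ := hpiece r
    rcases hs0.eq_or_lt with rfl | hs0
    · exact ⟨m, k, hk, by ring⟩
    · exact absurd (hint m k _ hk (by linarith) (by linarith)) hr
  -- Each discontinuity is also the end of an arc, which gives its left limit; the start of a period
  -- is the end of the last arc of the previous period.
  have hdisc' : ∀ r, ¬ ContinuousAt γ r → ∃ (m : ℤ) (k : ℕ), k < n ∧ r = m * L + t (k + 1) := by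
    intro r hr
    obtain ⟨m, k, hk, rfl⟩ := hdisc r hr
    cases k with
    | zero =>
      refine ⟨m - 1, n - 1, Nat.sub_lt hn one_pos, ?_⟩
      rw [Nat.sub_add_cancel (show 1 ≤ n from hn), ht0]
      push_cast
      ring
    | succ k => exact ⟨m, k, (Nat.lt_succ_self k).trans hk, rfl⟩
  have hright : ∀ r, ∀ᶠ s in 𝓝[≥] r, γ s = φ (s - r) (γ r) := by
    intro r
    obtain ⟨m, k, s, hk, hs0, hs, rfl⟩ := hpiece r
    have h2 : m * L + t k + s < m * L + t k + l k := by linarith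
    filter_upwards [Ico_mem_nhdsGE h2] with r' hr'
    rw [hγ m k s hk hs0 hs, hnear m k r' hk (by linarith [hr'.1]) hr'.2, ← φ.map_add]
    congr 1
    ring
  have hspacing : ∀ u v, ¬ ContinuousAt γ u → ¬ ContinuousAt γ v → u < v → T ≤ v - u := by
    intro u v hu hv huv
    obtain ⟨m, k, hk, rfl⟩ := hdisc u hu
    by_contra hlt
    exact hv (hint m k v hk huv (by linarith [hl k]))
  have hcont_iff : ∀ (m : ℤ) (k : ℕ), k < n → ContinuousAt γ (m * L + t (k + 1)) →
      φ (l k) (x k) = x (k + 1) := by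
    intro m k hk h
    have := tendsto_nhds_unique (h.mono_left nhdsWithin_le_nhds) (hleft m k hk)
    rw [← this, hmark m (k + 1) hk]
  have hball : ∀ k, k < n → φ (l k) (x k) ∈ Metric.ball (x (k + 1)) ε := fun k hk =>
    hb0 k hk ▸ hb k hk 0
  have hper : IsPeriodicPseudoOrbit φ ε T L γ := by
    refine ⟨hL, ?_, ?_, ?_, hspacing, ?_, ?_⟩
    · intro r
      obtain ⟨m, k, s, hk, hs0, hs, rfl⟩ := hpiece r
      rw [hγ m k s hk hs0 hs, ← hγ (m + 1) k s hk hs0 hs]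
      congr 1
      push_cast
      ring
    · intro r
      have h1 : ContinuousWithinAt (fun s => φ (s - r) (γ r)) (Ici r) r :=
        (hφc r (γ r)).continuousWithinAt
      exact h1.congr_of_eventuallyEq (hright r) (by simp [φ.map_zero_apply])
    · exact finite_of_spacing hT (fun u hu => Ico_subset_Icc_self hu.1)
        fun u hu v hv huv => hspacing u v hu.2 hv.2 huv
    · intro a b' hab hc
      refine eq_flow_of_eventually_eq (ψ := fun s y => φ s y) ?_ (fun y => φ.map_zero_apply y) ?_
        hab (fun r _ => (hright r).filter_mono (nhdsWithin_mono _ Ioi_subset_Ici_self)) hc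
      · intro s s' y
        rw [← φ.map_add, add_comm]
      · exact fun y => (φ.continuous continuous_id continuous_const).continuousOn
    · intro u hu
      obtain ⟨m, k, hk, rfl⟩ := hdisc' u hu
      refine ⟨_, hleft m k hk, ?_⟩
      rw [hmark m (k + 1) hk]
      exact Metric.mem_ball'.1 (hball k hk)
  -- The realization is built in `ℝ × M`, so that time and position stay coupled: orbit arcs advance
  -- the time, inserted curves keep it fixed.
  have hgood : ∀ k, k ≤ n → ∃ A : Path ((0 : ℝ), x 0) (t k, x k),
      (∀ s, A s ∈ realizationSet ε γ) ∧ Monotone (A.map continuous_fst) ∧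
      curveValue c (A.map continuous_snd).toContinuousMap = ∑ k ∈ Finset.range k,
        (curveValue c (orbitArc φ (l k) (x k)).toContinuousMap + curveValue c (b k)) := by
    intro k
    induction k with
    | zero =>
      intro _
      have h0 : γ 0 = x 0 := by simpa [ht0] using hmark 0 0 hn.le
      rw [ht0]
      refine ⟨Path.refl _, fun s => ⟨fun _ => h0.symm, fun _ => ?_⟩, fun _ _ _ => le_rfl, ?_⟩
      · change x 0 ∈ Metric.ball (γ 0) ε
        rw [h0]
        exact Metric.mem_ball_self hε
      · rw [Finset.sum_range_zero]
        exact curveValue_const c (x 0)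
    | succ k ih =>
      intro hk
      obtain ⟨A, hA, hAm, hAc⟩ := ih (Nat.le_of_succ_le hk)
      have hmk : γ (t (k + 1)) = x (k + 1) := by simpa using hmark 0 (k + 1) hk
      let B : Path (t k, x k) (t (k + 1), φ (l k) (x k)) :=
        { toFun := fun s => (t k + s * l k, φ (s * l k) (x k))
          continuous_toFun := Continuous.prodMk (by fun_prop)
            (φ.continuous (by fun_prop) continuous_const)
          source' := by simp [φ.map_zero_apply]
          target' := by simp [hts] }
      let D : Path (t (k + 1), φ (l k) (x k)) (t (k + 1), x (k + 1)) :=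
        { toFun := fun s => (t (k + 1), b k s)
          continuous_toFun := by fun_prop
          source' := by rw [hb0 k hk]
          target' := by rw [hb1 k hk] }
      have hBm : Monotone (B.map continuous_fst) := by
        intro s s' h
        change t k + s * l k ≤ t k + s' * l k
        have := mul_le_mul_of_nonneg_right (show (s : ℝ) ≤ s' from h) (hlpos k).le
        linarith
      have hDm : Monotone (D.map continuous_fst) := fun s s' h => le_rfl
      have hD : ∀ s, D s ∈ realizationSet ε γ := by
        intro s
        refine ⟨fun h => ?_, fun _ => ?_⟩
        · change b k s = γ (t (k + 1))
          rw [hmk]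
          have h' : ContinuousAt γ (t (k + 1)) := h
          refine hbc k hk (hcont_iff 0 k hk ?_) s
          simpa using h'
        · change b k s ∈ Metric.ball (γ (t (k + 1))) ε
          rw [hmk]
          exact hb k hk s
      have hB : ∀ s, B s ∈ realizationSet ε γ := by
        intro s
        -- The end of the arc is at a possible jump time but at the position before the jump, so it
        -- is treated as the start of the inserted curve.
        rcases (show (s : ℝ) ≤ 1 from s.2.2).eq_or_lt with h1 | h1
        · have : B s = D 0 := by
            rw [show s = 1 from Subtype.ext h1, B.target, D.source]
          rw [this]
          exact hD 0
        · have h0 : 0 ≤ (s : ℝ) * l k := mul_nonneg s.2.1 (hlpos k).le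
          have h2 : (s : ℝ) * l k < l k := mul_lt_of_lt_one_left (hlpos k) h1
          have h3 : γ (t k + s * l k) = φ (s * l k) (x k) := by
            simpa using hγ 0 k (s * l k) hk h0 h2
          refine ⟨fun _ => h3.symm, fun _ => ?_⟩
          change φ (s * l k) (x k) ∈ Metric.ball (γ (t k + s * l k)) ε
          rw [h3]
          exact Metric.mem_ball_self hε
      refine ⟨(A.trans B).trans D, ?_, ?_, ?_⟩
      · intro s
        rw [Path.trans_apply]
        split_ifs
        · rw [Path.trans_apply]
          split_ifs
          · exact hA _
          · exact hB _
        · exact hD _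
      · rw [Path.map_trans, Path.map_trans]
        exact monotone_trans (monotone_trans hAm hBm) hDm
      · rw [Path.map_trans, Path.map_trans, curveValue_trans, curveValue_trans, hAc,
          Finset.sum_range_succ, add_assoc]
        rfl
  obtain ⟨A, hA, hAm, hAc⟩ := hgood n le_rfl
  refine ⟨L, γ, (A.map continuous_snd).toContinuousMap, hper, ⟨?_,
    (A.map continuous_fst).toContinuousMap, hAm, ?_, hA⟩, hAc⟩
  · exact (A.map continuous_snd).source.trans (hx.symm.trans (A.map continuous_snd).target.symm)
  · refine (A.map continuous_fst).target.trans ?_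
    change _ = (A.map continuous_fst) 0 + L
    rw [(A.map continuous_fst).source, zero_add]

end

/-! ### From periodic pseudo-orbits to quasi-Lyapunov functions -/

section

open Cover

/-- A sequence with bounded increments that does not increase much between two indices of the
same color is bounded in terms of the number of colors. -/
theorem le_add_card_mul {ι : Type*} [DecidableEq ι] {col : ℕ → ι} {u : ℕ → ℝ} {C D : ℝ}
    (hC : 0 ≤ C) (hD : 0 ≤ D) {n : ℕ} (hstep : ∀ k < n, u (k + 1) ≤ u k + C)
    (hcol : ∀ i j, i < j → j ≤ n → col i = col j → u j ≤ u i + D) (S : Finset ι) :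
    ∀ i ≤ n, (∀ k, i ≤ k → k ≤ n → col k ∈ S) → u n ≤ u i + S.card * (C + D) := by
  induction S using Finset.strongInduction with
  | H S ih =>
    intro i hi hS
    -- Go to the last index with the colour of `i`, at cost `D`, then one step further, at cost `C`;
    -- this colour never occurs again and can be erased.
    obtain ⟨j, hij, hjn, hj, hmax⟩ : ∃ j, i ≤ j ∧ j ≤ n ∧ col i = col j ∧
        ∀ k, j < k → k ≤ n → col i ≠ col k := by
      obtain ⟨j, hj, hmax⟩ := Finset.exists_max_image
        ((Finset.Icc i n).filter (fun j => col i = col j)) id ⟨i, by simp [hi]⟩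
      simp only [Finset.mem_filter, Finset.mem_Icc, id] at hj hmax
      refine ⟨j, hj.1.1, hj.1.2, hj.2, fun k hk hkn h' => ?_⟩
      have := hmax k ⟨⟨hj.1.1.trans hk.le, hkn⟩, h'⟩
      omega
    have hji : u j ≤ u i + D := by
      rcases hij.eq_or_lt with rfl | h
      · linarith
      · exact hcol i j h hjn hj
    have hcard : (S.erase (col i)).card + 1 = S.card :=
      Finset.card_erase_add_one (hS i le_rfl hi)
    have hcard' : (S.card : ℝ) = (S.erase (col i)).card + 1 := by exact_mod_cast hcard.symm
    have hnn : 0 ≤ ((S.erase (col i)).card : ℝ) * (C + D) := by positivity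
    rw [hcard', add_mul, one_mul]
    rcases hjn.eq_or_lt with rfl | hlt
    · linarith
    · have h1 := ih (S.erase (col i)) (Finset.erase_ssubset (hS i le_rfl hi)) (j + 1) hlt
        fun k hk hkn => Finset.mem_erase.2
          ⟨(hmax k hk hkn).symm, hS k (by omega) hkn⟩
      have h2 := hstep j hlt
      linarith

section

variable {M : Type*} [MetricSpace M] {x₀ : M} {K : Submodule ℤ (H1 ℤ M)}
  {d : Cover x₀ K → Cover x₀ K → ℝ}

theorem IsLiftedMetric.t2Space (hd : IsLiftedMetric d) : T2Space (Cover x₀ K) :=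
  t2_iff_nhds.2 fun {_ _} _ =>
    hd.tendsto_unique (u := id) (tendsto_id.mono_left inf_le_left) (tendsto_id.mono_left inf_le_right)

/-- A pseudo-orbit is cut into orbit arcs whose lengths lie between `T` and `2T`. -/
theorem IsPseudoOrbit.exists_chain (hd : IsLiftedMetric d) {φ : Flow ℝ M} {ε T l : ℝ} (hε : 0 < ε)
    (hT : 0 < T) {γ : ℝ → Cover x₀ K} (hγ : IsPseudoOrbit (liftFlow φ) d ε T l γ) {t : ℝ}
    (ht : t ∈ Ico 0 l) :
    ∃ (n : ℕ) (x : ℕ → Cover x₀ K) (τ : ℕ → ℝ) (s : ℝ), x 0 = γ 0 ∧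
      (∀ k, T ≤ τ k) ∧ (∀ k, τ k ≤ 2 * T) ∧
      (∀ k < n, d (liftFlow φ (τ k) (x k)) (x (k + 1)) < ε) ∧
      0 ≤ s ∧ s ≤ 2 * T ∧ γ t = liftFlow φ s (x n) := by
  let D : ℝ → Prop := fun u => u ∈ Ico 0 l ∧ ¬ ContinuousWithinAt γ (Ico 0 l) u
  have hDT : ∀ u v, D u → D v → u < v → T ≤ v - u := fun u v hu hv h =>
    hγ.spacing u hu.1 v hv.1 hu.2 hv.2 h
  -- Cut at a discontinuity in `[s + T, s + 2T[` if there is one, and at `s + T` otherwise. The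
  -- invariant is that no discontinuity lies strictly between a cut and `T` later; it holds at time
  -- 0 since discontinuities avoid `[0, T[`.
  have hnext : ∀ s : ℝ, ∃ s', s + T ≤ s' ∧ s' ≤ s + 2 * T ∧ ((∀ u, D u → s < u → s + T ≤ u) →
      (∀ u, D u → s < u → s' ≤ u) ∧ ∀ u, D u → s' < u → s' + T ≤ u) := by
    intro s
    by_cases h : ∃ u, D u ∧ s + T ≤ u ∧ u < s + 2 * T
    · obtain ⟨u, hu, h1, h2⟩ := h
      refine ⟨u, h1, h2.le, fun hs => ⟨fun v hv hsv => ?_, fun v hv huv => ?_⟩⟩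
      · by_contra hvu
        have := hDT v u hv hu (not_le.1 hvu)
        have := hs v hv hsv
        linarith
      · have := hDT u v hu hv huv
        linarith
    · refine ⟨s + T, le_rfl, by linarith, fun hs => ⟨hs, fun v hv hsv => ?_⟩⟩
      by_contra hlt
      exact h ⟨v, hv, hsv.le, by linarith⟩
  choose next hn1 hn2 hn3 using hnext
  let σ : ℕ → ℝ := fun k => next^[k] 0
  have hσs : ∀ k, σ (k + 1) = next (σ k) := fun k => Function.iterate_succ_apply' next k 0
  have hσ1 : ∀ k, σ k + T ≤ σ (k + 1) := fun k => hσs k ▸ hn1 (σ k)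
  have hσ2 : ∀ k, σ (k + 1) ≤ σ k + 2 * T := fun k => hσs k ▸ hn2 (σ k)
  have hinv : ∀ k, ∀ u, D u → σ k < u → σ k + T ≤ u := by
    intro k
    induction k with
    | zero =>
      intro u hu _
      have h0 : σ 0 = 0 := rfl
      rw [h0, zero_add]
      exact hγ.disjoint u hu.1 hu.2
    | succ k ih =>
      rw [hσs]
      exact (hn3 (σ k) ih).2
  have hfree : ∀ k u, D u → σ k < u → σ (k + 1) ≤ u := fun k => by
    rw [hσs]
    exact (hn3 (σ k) (hinv k)).1
  have hσ0 : ∀ k : ℕ, k * T ≤ σ k := by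
    intro k
    induction k with
    | zero => simp [σ]
    | succ k ih =>
      push_cast
      linarith [hσ1 k]
  have hσnn : ∀ k, 0 ≤ σ k := fun k => (by positivity : (0 : ℝ) ≤ k * T).trans (hσ0 k)
  have hflow : ∀ k r, σ k ≤ r → r < l → (∀ u, D u → σ k < u → r < u) →
      γ r = liftFlow φ (r - σ k) (γ (σ k)) := by
    intro k r h1 h2 h3
    refine hγ.orbit (σ k) r (hσnn k) h1 h2 fun w hw => ?_
    have hwl : w ∈ Ico 0 l := ⟨(hσnn k).trans hw.1, hw.2.trans_lt h2⟩
    rcases hw.1.eq_or_lt with rfl | hlt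
    · exact (hγ.right_continuous _ hwl).mono fun z hz => ⟨hz.1, hz.2.trans_lt h2⟩
    · by_contra hc
      refine (h3 w ⟨hwl, fun hc' => hc (hc'.mono fun z hz => ?_)⟩ hlt).not_ge hw.2
      exact ⟨(hσnn k).trans hz.1, hz.2.trans_lt h2⟩
  have hjump : ∀ k, σ (k + 1) < l →
      d (liftFlow φ (σ (k + 1) - σ k) (γ (σ k))) (γ (σ (k + 1))) < ε := by
    intro k hk
    have hlt : σ k < σ (k + 1) := by linarith [hσ1 k]
    -- At a true discontinuity the end of the arc is the left limit; at an artificial cut there is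
    -- no jump.
    by_cases hD : D (σ (k + 1))
    · obtain ⟨y, hy, hdy⟩ := hγ.jump _ hD.1 hD.2
      obtain ⟨B, hB, hB'⟩ := exists_lift_orbit φ (γ (σ k))
      have hy' : Tendsto γ (𝓝[<] σ (k + 1)) (𝓝 (B (σ (k + 1) - σ k))) := by
        have h1 : Continuous fun r => B (r - σ k) := hB.comp (by fun_prop)
        refine ((h1.tendsto (σ (k + 1))).mono_left nhdsWithin_le_nhds).congr' ?_
        filter_upwards [Ioo_mem_nhdsLT hlt] with r hr
        rw [hB' _ (sub_nonneg.2 hr.1.le)]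
        exact (hflow k r hr.1.le (hr.2.trans hk) fun u hu h =>
          hr.2.trans_le (hfree k u hu h)).symm
      rw [← hB' _ (sub_nonneg.2 hlt.le), hd.tendsto_unique hy' hy, hd.symm]
      exact hdy
    · rw [← hflow k _ hlt.le hk fun u hu h => ?_, hd.self]
      · exact hε
      · refine (hfree k u hu h).lt_of_ne ?_
        rintro rfl
        exact hD hu
  have hex : ∃ k, t < σ (k + 1) := by
    obtain ⟨k, hk⟩ := exists_nat_gt (t / T)
    refine ⟨k, ?_⟩
    have h1 := (div_lt_iff₀ hT).1 hk
    linarith [hσ0 k, hσ1 k]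
  classical
  have hlast := Nat.find_spec hex
  have hbefore : ∀ k < Nat.find hex, σ (k + 1) ≤ t := fun k hk => not_lt.1 (Nat.find_min hex hk)
  set n := Nat.find hex
  have hnt : σ n ≤ t := by
    rcases Nat.eq_zero_or_pos n with h | h
    · rw [h]
      exact ht.1
    · have := hbefore (n - 1) (by omega)
      rwa [Nat.sub_add_cancel (show 1 ≤ n from h)] at this
  refine ⟨n, fun k => γ (σ k), fun k => σ (k + 1) - σ k, t - σ n, rfl, fun k => ?_, fun k => ?_,
    fun k hk => hjump k ((hbefore k hk).trans_lt ht.2), sub_nonneg.2 hnt, ?_, ?_⟩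
  · linarith [hσ1 k]
  · linarith [hσ2 k]
  · linarith [hσ2 n]
  · exact hflow n t hnt ht.2 fun u hu h => hlast.trans_le (hfree n u hu h)

variable [CompactSpace M] [LocallyPathConnectedSpace M] [ConnectedSpace M]

/-- If the class is nonpositive on the periodic pseudo-orbits, then the primitive does not increase
along the chains that are closed in the base. -/
theorem exists_forall_chain_primitive_le (hd : IsLiftedMetric d) {φ : Flow ℝ M} {ε T : ℝ}
    (hε : 0 < ε) (hT : 0 < T) {c : Cocycles M} (hK : K ≤ intKer (Submodule.Quotient.mk c))
    (h : ∀ (l : ℝ) (γ : ℝ → M), IsPeriodicPseudoOrbit φ ε T l γ →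
      ∀ h, IsClassOf ε l γ h → eval ℝ (Submodule.Quotient.mk c) h ≤ 0) :
    ∃ ρ > 0, ∀ (n : ℕ) (x : ℕ → Cover x₀ K) (τ : ℕ → ℝ), 0 < n → (∀ k, T ≤ τ k) →
      (∀ k < n, d (liftFlow φ (τ k) (x k)) (x (k + 1)) < ρ) → (x n).proj = (x 0).proj →
      primitive c (x n) ≤ primitive c (x 0) := by
  -- The inserted curves stay in an `ε / 2`-ball around their start, hence in the `ε`-ball around
  -- their end, as realizations require.
  obtain ⟨ρ, hρ, hlink⟩ := hd.exists_forall_exists_link (half_pos hε)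
  refine ⟨ρ, hρ, fun n x τ hn hτ hx hclosed => ?_⟩
  have hb : ∀ k, ∃ a : C(unitInterval, M), k < n →
      Link (liftFlow φ (τ k) (x k)) a (x (k + 1)) ∧
      (∀ t, a t ∈ Metric.ball (φ (τ k) (x k).proj) (ε / 2)) ∧
      (φ (τ k) (x k).proj = (x (k + 1)).proj → ∀ t, a t = φ (τ k) (x k).proj) := by
    intro k
    by_cases hk : k < n
    · obtain ⟨a, h1, h2, h3⟩ := hlink _ _ (hx k hk)
      simp only [proj_liftFlow] at h2 h3
      exact ⟨a, fun _ => ⟨h1, h2, h3⟩⟩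
    · exact ⟨ContinuousMap.const _ x₀, fun h => absurd h hk⟩
  choose b hb using hb
  obtain ⟨L, γ, Γ, hper, hΓ, hval⟩ := exists_periodicPseudoOrbit φ (ε := ε) hT c hn
    (fun k => (x k).proj) τ hτ hclosed b
    (fun k hk => (hb k hk).1.proj_left.symm.trans (proj_liftFlow _ _ _))
    (fun k hk => (hb k hk).1.proj_right.symm)
    (fun k hk t => by
      have h1 := (hb k hk).2.1 t
      have h2 := (hb k hk).2.1 1
      rw [← (hb k hk).1.proj_right] at h2
      have := dist_triangle_right (b k t) (x (k + 1)).proj (φ (τ k) (x k).proj)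
      rw [Metric.mem_ball] at *
      linarith)
    (fun k hk e t => ((hb k hk).2.2 e t).trans e)
  have h0 := h L γ hper _ ⟨Γ, hΓ, rfl⟩
  rw [eval_loopClass, hval] at h0
  have htel : ∀ k ≤ n, primitive c (x k) = primitive c (x 0) + ∑ j ∈ Finset.range k,
      (curveValue c (orbitArc φ (τ j) (x j).proj).toContinuousMap + curveValue c (b j)) := by
    intro k
    induction k with
    | zero => simp
    | succ k ih =>
      intro hk
      rw [Finset.sum_range_succ, (hb k hk).1.primitive_eq hK,
        (link_liftFlow φ (τ k) (x k)).primitive_eq hK, ih (Nat.le_of_succ_le hk)]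
      ring
  rw [htel n le_rfl]
  linarith

/-- Recurrence in the base bounds the growth: cut points of the same colour are nearly over each
other, so the piece between them can be closed up and `f` grows by at most 1 along it. -/
theorem isQuasiLyapunov_of_forall_periodic (hd : IsLiftedMetric d) {φ : Flow ℝ M} {ε T : ℝ}
    (hε : 0 < ε) (hT : 0 < T) {c : Cocycles M} (hK : K ≤ intKer (Submodule.Quotient.mk c))
    (h : ∀ (l : ℝ) (γ : ℝ → M), IsPeriodicPseudoOrbit φ ε T l γ →
      ∀ h, IsClassOf ε l γ h → eval ℝ (Submodule.Quotient.mk c) h ≤ 0) :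
    IsQuasiLyapunov φ T d (Submodule.Quotient.mk c) := by
  intro f hfc hf
  obtain ⟨ρ, hρ, hvar⟩ := hd.exists_forall_le_add_one hK hfc hf
  obtain ⟨C, hC, hflow⟩ := hd.exists_forall_liftFlow_le hK hfc hf φ (2 * T)
  obtain ⟨ρ', hρ', hloop⟩ := exists_forall_chain_primitive_le hd hε hT hK h
  obtain ⟨ε₁, hε₁, hlink⟩ := hd.exists_forall_link_lt (lt_min hρ (half_pos hρ'))
  obtain ⟨ε₂, hε₂, hjoin⟩ := exists_forall_joinedIn_ball (M := M) hε₁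
  obtain ⟨Z, hZ⟩ : ∃ Z : Finset M, ∀ x : M, ∃ z ∈ Z, dist x z < ε₂ / 2 := by
    obtain ⟨Z, -, hZf, hZ⟩ :=
      finite_cover_balls_of_compact (isCompact_univ (X := M)) (half_pos hε₂)
    refine ⟨hZf.toFinset, fun x => ?_⟩
    obtain ⟨z, hz, hx⟩ := mem_iUnion₂.1 (hZ (mem_univ x))
    exact ⟨z, hZf.mem_toFinset.2 hz, hx⟩
  choose N hNZ hN using hZ
  classical
  -- Each arc with its jump contributes at most `C + 1`, each return to a colour at most 1; the
  -- separate `C` is for the last, incomplete arc.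
  refine ⟨C + Z.card * (C + 1 + 1), by positivity, min ρ (ρ' / 2), lt_min hρ (half_pos hρ'),
    fun l γ hγ t ht => ?_⟩
  obtain ⟨n, x, τ, s, hx0, hτ, hτ', hx, hs, hs', hγt⟩ :=
    hγ.exists_chain hd (lt_min hρ (half_pos hρ')) hT ht
  have hbound := le_add_card_mul (col := fun k => N (x k).proj) (u := fun k => f (x k))
    (C := C + 1) (D := 1) (by positivity) zero_le_one (n := n) (fun k hk => ?_)
    (fun i j hij hj he => ?_) Z 0 (Nat.zero_le n) fun k _ _ => hNZ _
  · have h1 := hflow (x n) s hs hs'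
    rw [hγt, ← hx0]
    linarith
  · have h1 := hvar _ _ ((hx k hk).trans_le (min_le_left _ _))
    have h2 := hflow (x k) (τ k) (hT.le.trans (hτ k)) (hτ' k)
    linarith
  · have hdist : dist (x j).proj (x i).proj < ε₂ := by
      have h1 := hN (x i).proj
      have h2 := hN (x j).proj
      have := dist_triangle_right (x j).proj (x i).proj (N (x j).proj)
      have he' : N (x i).proj = N (x j).proj := he
      rw [← he'] at this h2
      linarith
    obtain ⟨a, ha⟩ := hjoin _ _ hdist
    obtain ⟨z, hz⟩ := Link.exists_right (x j) a.toContinuousMap a.source.symm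
    have hdz := hlink _ _ _ _ ha hz
    have hzp : z.proj = (x i).proj := hz.proj_right.trans a.target
    have hfz := hvar z (x j) (by rw [hd.symm]; exact hdz.trans_le (min_le_left _ _))
    -- Only the final point is changed, from `x j` to the nearby `z` over the projection of `x i`.
    -- The last jump is then less than `ρ' / 2 + ρ' / 2`, and replacing `x j` by `z` costs at most 1
    -- in `f`.
    let y : ℕ → Cover x₀ K := fun k => if k < j - i then x (i + k) else z
    have hy0 : y 0 = x i := by simp [y, hij]
    have hyn : y (j - i) = z := by simp [y]
    have hloop' := hloop (j - i) y (fun k => τ (i + k)) (by omega) (fun k => hτ _)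
      (fun k hk => ?_) (by rw [hy0, hyn, hzp])
    · rw [hy0, hyn] at hloop'
      have := (isEquivariant_iff hK).1 hf (x i) z hzp.symm
      linarith
    · have hyk : y k = x (i + k) := by simp [y, hk]
      have h1 := hx (i + k) (by omega)
      have h1' := h1.trans_le (min_le_right _ _)
      rw [hyk]
      by_cases hk' : k + 1 < j - i
      · have : y (k + 1) = x (i + k + 1) := by simp [y, hk', add_assoc]
        rw [this]
        linarith
      · have e1 : y (k + 1) = z := by simp [y, hk']
        have e2 : i + k + 1 = j := by omega
        rw [e1]
        rw [e2] at h1'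
        have h3 := hdz.trans_le (min_le_right _ _)
        have := hd.triangle (liftFlow φ (τ (i + k)) (x (i + k))) (x j) z
        linarith

end

end

/-! ### From quasi-Lyapunov classes to periodic pseudo-orbits -/

section

open Cover

section adjoint

variable {τ σ : ℝ → ℝ}

/-- For the time function of a realization, `σ v` is the last parameter at time `v`, that is, just
after the inserted curve; the left adjoint is the first such parameter. -/
theorem exists_right_adjoint (hc : Continuous τ) (hm : Monotone τ) (hs : Function.Surjective τ) :
    ∃ σ : ℝ → ℝ, ∀ v s, τ s ≤ v ↔ s ≤ σ v := by
  refine ⟨fun v => sSup {s | τ s ≤ v}, fun v s => ?_⟩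
  have hne : {s | τ s ≤ v}.Nonempty := by
    obtain ⟨s, hs⟩ := hs v
    exact ⟨s, hs.le⟩
  have hb : BddAbove {s | τ s ≤ v} := by
    obtain ⟨s₁, hs₁⟩ := hs (v + 1)
    refine ⟨s₁, fun s (hs : τ s ≤ v) => ?_⟩
    by_contra h
    have := hm (not_le.1 h).le
    linarith
  have hcl : IsClosed {s | τ s ≤ v} := isClosed_le hc continuous_const
  exact ⟨fun h => le_csSup hb h, fun h => (hm h).trans (hcl.csSup_mem hne hb)⟩

theorem exists_left_adjoint (hc : Continuous τ) (hm : Monotone τ) (hs : Function.Surjective τ) :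
    ∃ σ : ℝ → ℝ, ∀ v s, v ≤ τ s ↔ σ v ≤ s := by
  obtain ⟨σ, hσ⟩ := exists_right_adjoint (τ := fun s => -τ (-s)) (by fun_prop)
    (fun a b h => neg_le_neg (hm (neg_le_neg h))) fun v => by
      obtain ⟨s, hs⟩ := hs (-v)
      exact ⟨-s, by simp [hs]⟩
  refine ⟨fun v => -σ (-v), fun v s => ?_⟩
  have := hσ (-v) (-s)
  rw [neg_neg, neg_le_neg_iff] at this
  rw [this, neg_le]

theorem apply_right_adjoint (hs : Function.Surjective τ) (hm : Monotone τ)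
    (h : ∀ v s, τ s ≤ v ↔ s ≤ σ v) (v : ℝ) : τ (σ v) = v := by
  refine le_antisymm ((h v _).2 le_rfl) ?_
  obtain ⟨s, rfl⟩ := hs v
  exact hm ((h _ _).1 le_rfl)

theorem continuousWithinAt_right_adjoint (h : ∀ v s, τ s ≤ v ↔ s ≤ σ v) (v : ℝ) :
    ContinuousWithinAt σ (Ici v) v := by
  refine tendsto_order.2 ⟨fun s hs => ?_, fun s hs => ?_⟩
  · filter_upwards [self_mem_nhdsWithin] with w hw
    exact hs.trans_le ((h w _).1 (((h v _).2 le_rfl).trans hw))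
  · have hv : v < τ s := not_le.1 fun h' => hs.not_ge ((h v s).1 h')
    filter_upwards [Ico_mem_nhdsGE hv] with w hw
    exact not_le.1 fun h' => hw.2.not_ge ((h w s).2 h')

/-- The jump from `σ' v` to `σ v` is exactly the parameter interval on which the time stays equal to
`v`. -/
theorem tendsto_right_adjoint_left {σ' : ℝ → ℝ} (hs : Function.Surjective τ) (hm : Monotone τ)
    (h : ∀ v s, τ s ≤ v ↔ s ≤ σ v) (h' : ∀ v s, v ≤ τ s ↔ σ' v ≤ s) (v : ℝ) :
    Tendsto σ (𝓝[<] v) (𝓝 (σ' v)) := by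
  refine tendsto_order.2 ⟨fun s hsv => ?_, fun s hsv => ?_⟩
  · obtain ⟨s₁, h1, h2⟩ := exists_between hsv
    have hv : τ s₁ < v := not_le.1 fun hle => h2.not_ge ((h' v s₁).1 hle)
    filter_upwards [Ioo_mem_nhdsLT hv] with w hw
    exact h1.trans_le ((h w s₁).1 hw.1.le)
  · filter_upwards [self_mem_nhdsWithin] with w hw
    refine lt_of_le_of_lt (not_lt.1 fun hlt => ?_) hsv
    have h1 := (h' v (σ w)).2 hlt.le
    rw [apply_right_adjoint hs hm h] at h1
    exact (show w < v from hw).not_ge h1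

end adjoint

section

variable {M : Type*} [MetricSpace M]

namespace IsPeriodicPseudoOrbit

variable {φ : Flow ℝ M} {ε T l : ℝ} {γ : ℝ → M}

theorem eventually_continuousAt (hγ : IsPeriodicPseudoOrbit φ ε T l γ) (hT : 0 < T) (v : ℝ) :
    ∃ δ > 0, ∀ w, v < w → w < v + δ → ContinuousAt γ w := by
  by_cases h : ∃ u, ¬ ContinuousAt γ u ∧ v < u ∧ u < v + T
  · obtain ⟨u, hu, h1, h2⟩ := h
    refine ⟨u - v, sub_pos.2 h1, fun w hw hw' => ?_⟩
    by_contra hc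
    have := hγ.spacing w u hc hu (by linarith)
    linarith
  · refine ⟨T, hT, fun w hw hw' => ?_⟩
    by_contra hc
    exact h ⟨w, hc, hw, hw'⟩

theorem eventually_eq_flow (hγ : IsPeriodicPseudoOrbit φ ε T l γ) (hT : 0 < T) (v : ℝ) :
    ∀ᶠ w in 𝓝[>] v, γ w = φ (w - v) (γ v) := by
  obtain ⟨δ, hδ, h⟩ := hγ.eventually_continuousAt hT v
  filter_upwards [Ioo_mem_nhdsGT (show v < v + δ by linarith)] with w hw
  refine hγ.orbit v w hw.1.le fun u hu => ?_
  rcases hu.1.eq_or_lt with rfl | hlt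
  · exact (hγ.right_continuous _).mono fun z hz => hz.1
  · exact (h u hlt (hu.2.trans_lt hw.2)).continuousWithinAt

theorem apply_add_int_mul (hγ : IsPeriodicPseudoOrbit φ ε T l γ) (t : ℝ) (k : ℤ) :
    γ (t + l * k) = γ t := by
  rw [mul_comm]
  exact hγ.periodic.int_mul k t

theorem continuousAt_add_int_mul (hγ : IsPeriodicPseudoOrbit φ ε T l γ) (t : ℝ) (k : ℤ) :
    ContinuousAt γ (t + l * k) ↔ ContinuousAt γ t := by
  have hγ' : (fun s => γ (s + l * k)) = γ := funext fun s => hγ.apply_add_int_mul s k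
  have hγ'' : (fun s => γ (s + -(l * k))) = γ := funext fun s => by
    have := hγ.apply_add_int_mul s (-k)
    push_cast at this
    rwa [mul_neg] at this
  constructor
  · intro h
    have h1 : ContinuousAt (fun s => γ (s + l * k)) t :=
      ContinuousAt.comp (f := fun s => s + l * k) h (by fun_prop)
    rwa [hγ'] at h1
  · intro h
    have h1 : ContinuousAt (fun s => γ (s + -(l * k))) (t + l * k) := by
      refine ContinuousAt.comp (f := fun s => s + -(l * k)) ?_ (by fun_prop)
      simpa using h
    rwa [hγ''] at h1

/-- A realization of a periodic pseudo-orbit, seen as a periodic curve on `ℝ`. -/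
theorem exists_periodic_realization (hγ : IsPeriodicPseudoOrbit φ ε T l γ)
    {Γ : C(unitInterval, M)} (hΓ : IsRealization ε l γ Γ) :
    ∃ (A : C(ℝ, M)) (τ : ℝ → ℝ), Continuous τ ∧ Monotone τ ∧ Function.Surjective τ ∧
      (∀ s (k : ℤ), τ (s + k) = τ s + l * k) ∧ (∀ s (k : ℤ), A (s + k) = A s) ∧
      (∀ s, (τ s, A s) ∈ realizationSet ε γ) ∧ seg A 0 1 = Γ := by
  obtain ⟨τ₀, hm, hτ₁, hgood⟩ := hΓ.exists_time
  have hl := hγ.length_pos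
  let G : ℝ → M := fun s => Γ (projIcc 0 1 zero_le_one s)
  let F : ℝ → ℝ := fun s => τ₀ (projIcc 0 1 zero_le_one s)
  have hG : Continuous G := by fun_prop
  have hF : Continuous F := by fun_prop
  have hFm : Monotone F := hm.comp (monotone_projIcc _)
  have hF0 : F 0 = τ₀ 0 := congrArg τ₀ (projIcc_left _)
  have hF1 : F 1 = τ₀ 0 + l := (congrArg τ₀ (projIcc_right _)).trans hτ₁
  let A : C(ℝ, M) := ⟨fun s => G (Int.fract s), by
    refine ContinuousOn.comp_fract'' hG.continuousOn ?_
    simp only [G, projIcc_left, projIcc_right]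
    exact hΓ.closed⟩
  let τ : ℝ → ℝ := fun s => F (Int.fract s) + l * ⌊s⌋
  have hτc : Continuous τ := by
    -- Subtracting the linear part `l * s` leaves a function of the fractional part that takes equal
    -- values at 0 and 1.
    have h1 : Continuous fun s => (fun u => F u - l * u) (Int.fract s) := by
      refine ContinuousOn.comp_fract'' (f := fun u => F u - l * u) (by fun_prop) ?_
      rw [hF0, hF1]
      ring
    have h2 : τ = fun s => (fun u => F u - l * u) (Int.fract s) + l * s := by
      funext s
      have := Int.fract_add_floor s
      simp only [τ]
      linear_combination l * this
    rw [h2]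
    fun_prop
  have hlow : ∀ s, τ₀ 0 + l * ⌊s⌋ ≤ τ s := fun s => by
    have := hFm (Int.fract_nonneg s)
    rw [hF0] at this
    simp only [τ]
    linarith
  have hhigh : ∀ s, τ s ≤ τ₀ 0 + l + l * ⌊s⌋ := fun s => by
    have := hFm (Int.fract_lt_one s).le
    rw [hF1] at this
    simp only [τ]
    linarith
  have hτm : Monotone τ := by
    intro s s' h
    rcases (Int.floor_le_floor h).eq_or_lt with he | hlt
    · have h1 : Int.fract s ≤ Int.fract s' := by
        rw [Int.fract, Int.fract, he]
        linarith
      have := hFm h1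
      simp only [τ, he]
      linarith
    · have h1 : (⌊s⌋ : ℝ) + 1 ≤ ⌊s'⌋ := by exact_mod_cast hlt
      have h2 := mul_le_mul_of_nonneg_left h1 hl.le
      linarith [hhigh s, hlow s']
  refine ⟨A, τ, hτc, hτm, ?_, ?_, ?_, ?_, ?_⟩
  · refine hτc.surjective (tendsto_atTop.2 fun b => ?_) (tendsto_atBot.2 fun b => ?_)
    · filter_upwards [eventually_ge_atTop ((b - τ₀ 0) / l + 1)] with s hs
      have h1 := (Int.lt_floor_add_one s).le
      have h2 : (b - τ₀ 0) / l ≤ ⌊s⌋ := by linarith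
      rw [div_le_iff₀ hl] at h2
      linarith [hlow s]
    · filter_upwards [eventually_le_atBot ((b - τ₀ 0 - l) / l)] with s hs
      have h2 : (⌊s⌋ : ℝ) ≤ (b - τ₀ 0 - l) / l := (Int.floor_le s).trans hs
      rw [le_div_iff₀ hl] at h2
      linarith [hhigh s]
  · intro s k
    simp only [τ, Int.fract_add_intCast, Int.floor_add_intCast]
    push_cast
    ring
  · intro s k
    change G _ = G _
    rw [Int.fract_add_intCast]
  · intro s
    obtain ⟨h1, h2⟩ := hgood (projIcc 0 1 zero_le_one (Int.fract s))
    refine ⟨fun h => ?_, fun h => ?_⟩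
    · change G (Int.fract s) = γ (F (Int.fract s) + l * ⌊s⌋)
      rw [hγ.apply_add_int_mul]
      exact h1 ((hγ.continuousAt_add_int_mul _ _).1 h)
    · change G (Int.fract s) ∈ Metric.ball (γ (F (Int.fract s) + l * ⌊s⌋)) ε
      rw [hγ.apply_add_int_mul]
      exact h2 fun h' => h ((hγ.continuousAt_add_int_mul _ _).2 h')
  · ext t
    change G (Int.fract (0 + (1 - 0) * (t : ℝ))) = Γ t
    rw [sub_zero, one_mul, zero_add]
    rcases (show (t : ℝ) ≤ 1 from t.2.2).eq_or_lt with h | h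
    · rw [h, Int.fract_one, show t = 1 from Subtype.ext h, ← hΓ.closed]
      simp only [G, projIcc_left]
      rfl
    · rw [Int.fract_eq_self.2 ⟨t.2.1, h⟩]
      exact congrArg Γ (projIcc_val _ _)

end IsPeriodicPseudoOrbit

/-- The value over a period does not depend on the starting point, by additivity along segments and
invariance under integer shifts. -/
theorem curveValue_seg_nat (c : Cocycles M) {A : C(ℝ, M)} (hA : ∀ s (k : ℤ), A (s + k) = A s)
    (s : ℝ) (k : ℕ) : curveValue c (seg A s (s + k)) = k * curveValue c (seg A 0 1) := by
  have hshift : ∀ a b (k : ℤ), seg A (a + k) (b + k) = seg A a b := by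
    intro a b k
    ext t
    rw [seg_apply, seg_apply, ← hA (a + (b - a) * t) k]
    congr 1
    ring
  have hself : ∀ a, curveValue c (seg A a a) = 0 := fun a => by
    have := curveValue_seg_add c A a a a
    linarith
  have hone : ∀ a, curveValue c (seg A a (a + 1)) = curveValue c (seg A 0 1) := by
    intro a
    have h1 := curveValue_seg_add c A a 0 (a + 1)
    have h2 := curveValue_seg_add c A 0 1 (a + 1)
    have h3 := curveValue_seg_add c A 0 a 0
    have h4 := curveValue_seg_add c A a 0 a
    have h5 := hshift 0 a 1
    rw [Int.cast_one, zero_add] at h5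
    rw [h5] at h2
    rw [hself] at h4
    linarith
  induction k with
  | zero => simp [hself]
  | succ k ih =>
    have h1 := curveValue_seg_add c A s (s + k) (s + k + 1)
    rw [ih, hone] at h1
    push_cast
    rw [← add_assoc, ← h1]
    ring

variable {x₀ : M} {K : Submodule ℤ (H1 ℤ M)} {d : Cover x₀ K → Cover x₀ K → ℝ}

/-- A realization of a periodic pseudo-orbit lifts it to pseudo-orbits of any length of the
covering. -/
theorem IsPeriodicPseudoOrbit.exists_lift (hd : IsLiftedMetric d) {φ : Flow ℝ M} {ε ε' T l : ℝ}
    (hT : 0 < T) {c : Cocycles M} (hK : K ≤ intKer (Submodule.Quotient.mk c))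
    (hlink : ∀ (z : M) (a : C(unitInterval, M)) (x y : Cover x₀ K),
      (∀ t, a t ∈ Metric.ball z ε) → Link x a y → d x y < ε')
    (hsurj : ∀ z : M, ∃ x : Cover x₀ K, x.proj = z)
    {γ : ℝ → M} (hγ : IsPeriodicPseudoOrbit φ ε T l γ)
    {Γ : C(unitInterval, M)} (hΓ : IsRealization ε l γ Γ) :
    ∃ β : ℝ → Cover x₀ K, (∀ L, 0 < L → IsPseudoOrbit (liftFlow φ) d ε' T L β) ∧
      ∀ k : ℕ, (β (l * k)).proj = (β 0).proj ∧
        primitive c (β (l * k)) = primitive c (β 0) + k * curveValue c Γ := by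
  obtain ⟨A, τ, hτc, hτm, hτs, hτp, hAp, hA, hAΓ⟩ := hγ.exists_periodic_realization hΓ
  obtain ⟨σ, hσ⟩ := exists_right_adjoint hτc hτm hτs
  obtain ⟨σ', hσ'⟩ := exists_left_adjoint hτc hτm hτs
  have hτσ := apply_right_adjoint hτs hτm hσ
  have hσm : Monotone σ := fun v w h => (hσ w _).1 (((hσ v _).2 le_rfl).trans h)
  have hσσ' : ∀ v, σ' v ≤ σ v := fun v => (hσ' v _).1 (hτσ v).ge
  have hlt : ∀ v w, v < w → σ v ≤ σ' w := fun v w h => by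
    by_contra hlt
    have := (hσ' w (σ v)).2 (not_le.1 hlt).le
    rw [hτσ] at this
    linarith
  have hτeq : ∀ v s, σ' v ≤ s → s ≤ σ v → τ s = v := fun v s h1 h2 =>
    le_antisymm ((hσ v s).2 h2) ((hσ' v s).2 h1)
  have hσc := continuousWithinAt_right_adjoint hσ
  -- At a discontinuity a realization is only known to lie in a ball. The equality is obtained as a
  -- limit from the right, where the times are continuity times.
  have hAσ : ∀ v, A (σ v) = γ v := by
    intro v
    have h1 : Tendsto (fun w => A (σ w)) (𝓝[>] v) (𝓝 (A (σ v))) :=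
      (A.continuous.tendsto _).comp ((hσc v).mono_left (nhdsWithin_mono _ Ioi_subset_Ici_self))
    have h2 : Tendsto γ (𝓝[>] v) (𝓝 (γ v)) :=
      (hγ.right_continuous v).mono_left (nhdsWithin_mono _ Ioi_subset_Ici_self)
    refine tendsto_nhds_unique h1 (h2.congr' ?_)
    obtain ⟨δ, hδ, hcont⟩ := hγ.eventually_continuousAt hT v
    filter_upwards [Ioo_mem_nhdsGT (show v < v + δ by linarith)] with w hw
    have h3 := (hA (σ w)).1
    simp only [hτσ] at h3
    exact (h3 (hcont w hw.1 hw.2)).symm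
  -- Starting at a discontinuity, if there is one, leaves a free interval of length `T`, as required
  -- at the beginning of a pseudo-orbit on a half-line.
  obtain ⟨v₀, hv₀⟩ : ∃ v₀, ∀ u, ¬ ContinuousAt γ u → v₀ < u → v₀ + T ≤ u := by
    by_cases h : ∃ v, ¬ ContinuousAt γ v
    · obtain ⟨v, hv⟩ := h
      exact ⟨v, fun u hu huv => by linarith [hγ.spacing v u hv hu huv]⟩
    · exact ⟨0, fun u hu => absurd ⟨u, hu⟩ h⟩
  set s₀ := σ v₀
  let A' : C(ℝ, M) := ⟨fun s => A (s₀ + s), by fun_prop⟩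
  obtain ⟨x, hx⟩ := hsurj (A' 0)
  obtain ⟨B, hB, hB0, hBl⟩ := Cover.exists_lift x A' hx
  have hseg : ∀ a b, seg A' a b = seg A (s₀ + a) (s₀ + b) := fun a b => by
    ext t
    change A (s₀ + (a + (b - a) * t)) = A (s₀ + a + (s₀ + b - (s₀ + a)) * t)
    congr 1
    ring
  have hlink' : ∀ a b, s₀ ≤ a → s₀ ≤ b → Link (B (a - s₀)) (seg A a b) (B (b - s₀)) := by
    intro a b ha hb
    have := hBl (a - s₀) (b - s₀) (sub_nonneg.2 ha) (sub_nonneg.2 hb)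
    rwa [hseg, add_sub_cancel, add_sub_cancel] at this
  let β : ℝ → Cover x₀ K := fun t => B (σ (v₀ + t) - s₀)
  have hσ0 : ∀ t, 0 ≤ t → s₀ ≤ σ (v₀ + t) := fun t ht => hσm (by linarith)
  have hβp : ∀ t, 0 ≤ t → (β t).proj = γ (v₀ + t) := fun t ht => by
    have := (hlink' _ _ (hσ0 t ht) (hσ0 t ht)).proj_left
    rwa [seg_zero, hAσ] at this
  have hβr : ∀ t, ContinuousWithinAt β (Ici t) t := fun t => by
    have h1 : ContinuousWithinAt (fun t => σ (v₀ + t)) (Ici t) t :=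
      ContinuousWithinAt.comp (t := Ici (v₀ + t)) (hσc (v₀ + t)) (by fun_prop) fun u hu => by
        simpa using hu
    exact hB.continuousAt.comp_continuousWithinAt (h1.sub continuousWithinAt_const)
  have hβl : ∀ t, Tendsto β (𝓝[<] t) (𝓝 (B (σ' (v₀ + t) - s₀))) := fun t => by
    have h1 : Tendsto (fun t => v₀ + t) (𝓝[<] t) (𝓝[<] (v₀ + t)) := by
      refine tendsto_nhdsWithin_iff.2 ⟨?_, ?_⟩
      · exact ((by fun_prop : Continuous fun t : ℝ => v₀ + t).tendsto t).mono_left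
          nhdsWithin_le_nhds
      · filter_upwards [self_mem_nhdsWithin] with u hu
        simpa using hu
    exact (hB.tendsto _).comp
      (((tendsto_right_adjoint_left hτs hτm hσ hσ' (v₀ + t)).comp h1).sub tendsto_const_nhds)
  have hsegτ : ∀ v (u : unitInterval), ∃ s, τ s = v ∧ seg A (σ' v) (σ v) u = A s := fun v u =>
    ⟨_, hτeq v _ (by nlinarith [u.2.1, hσσ' v]) (by nlinarith [u.2.2, hσσ' v]), rfl⟩
  -- At a continuity time the realization is constant between the first and last parameters, so its
  -- lift has equal ends and the left limit is the value.
  have hβc : ∀ t, 0 < t → ContinuousAt γ (v₀ + t) → ContinuousAt β t := by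
    intro t ht hc
    refine continuousAt_iff_continuous_left'_right'.2
      ⟨?_, (hβr t).mono Ioi_subset_Ici_self⟩
    have h1 := hlink' _ _ (hlt v₀ (v₀ + t) (by linarith)) (hσ0 t ht.le)
    have h2 : seg A (σ' (v₀ + t)) (σ (v₀ + t)) = ContinuousMap.const _ (γ (v₀ + t)) := by
      ext u
      obtain ⟨s, hs, hs'⟩ := hsegτ (v₀ + t) u
      have h3 := (hA s).1
      simp only [hs] at h3
      rw [hs', h3 hc]
      rfl
    have h3 : (B (σ' (v₀ + t) - s₀)).proj = γ (v₀ + t) := by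
      rw [h1.proj_left, h2]
      rfl
    rw [h2, ← h3] at h1
    have h4 : B (σ (v₀ + t) - s₀) = B (σ' (v₀ + t) - s₀) := h1.unique (Link.const _)
    have h5 := hβl t
    rw [← h4] at h5
    exact h5
  have hβd : ∀ L, ∀ u ∈ Ico 0 L, ¬ ContinuousWithinAt β (Ico 0 L) u →
      0 < u ∧ ¬ ContinuousAt γ (v₀ + u) := by
    intro L u hu hc
    have h0 : 0 < u := by
      refine hu.1.lt_of_ne ?_
      rintro rfl
      exact hc ((hβr 0).mono fun z hz => hz.1)
    exact ⟨h0, fun h => hc (hβc u h0 h).continuousWithinAt⟩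
  have hspacing : ∀ L, ∀ u ∈ Ico 0 L, ∀ v ∈ Ico 0 L, ¬ ContinuousWithinAt β (Ico 0 L) u →
      ¬ ContinuousWithinAt β (Ico 0 L) v → u < v → T ≤ v - u := by
    intro L u hu v hv hcu hcv huv
    have := hγ.spacing _ _ (hβd L u hu hcu).2 (hβd L v hv hcv).2 (by linarith)
    linarith
  obtain ⟨r, hr, hiso⟩ := hd.isometry_on_balls
  refine ⟨β, fun L hL => ⟨hL, fun t _ => (hβr t).mono fun z hz => hz.1, ?_, ?_, hspacing L, ?_, ?_⟩,
    fun k => ?_⟩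
  · exact finite_of_spacing hT (fun u hu => Ico_subset_Icc_self hu.1)
      fun u hu v hv huv => hspacing L u hu.1 v hv.1 hu.2 hv.2 huv
  · intro u hu hc
    obtain ⟨h1, h2⟩ := hβd L u hu hc
    have := hv₀ _ h2 (by linarith)
    linarith
  · intro a b ha hab _ hc
    have := hd.t2Space
    refine eq_flow_of_eventually_eq (liftFlow_add φ) (liftFlow_zero φ) (fun y => ?_) hab ?_ hc
    · obtain ⟨D, hD, hD'⟩ := exists_lift_orbit φ y
      exact hD.continuousOn.congr fun s hs => (hD' s hs).symm
    · intro t ht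
      have ht0 : 0 ≤ t := ha.trans ht.1
      obtain ⟨D, hD, hD'⟩ := exists_lift_orbit φ (β t)
      -- Just after `t`, the lift and the lifted orbit are both within `r` of `β t` and have the
      -- same projection, hence agree by the isometry on balls.
      have h1 : ∀ᶠ s in 𝓝[>] t, d (β t) (β s) < r :=
        hd.tendsto_iff.1 ((hβr t).mono_left (nhdsWithin_mono _ Ioi_subset_Ici_self)) r hr
      have h2 : ∀ᶠ s in 𝓝[>] t, d (β t) (D (s - t)) < r := by
        have h3 : Continuous fun s => D (s - t) := hD.comp (by fun_prop)
        have h4 := h3.tendsto t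
        rw [sub_self, hD' 0 le_rfl, liftFlow_zero] at h4
        exact hd.tendsto_iff.1 (h4.mono_left nhdsWithin_le_nhds) r hr
      have h3 : ∀ᶠ s in 𝓝[>] t, γ (v₀ + s) = φ (s - t) (γ (v₀ + t)) := by
        have h4 : Tendsto (fun t => v₀ + t) (𝓝[>] t) (𝓝[>] (v₀ + t)) := by
          refine tendsto_nhdsWithin_iff.2 ⟨?_, ?_⟩
          · exact ((by fun_prop : Continuous fun t : ℝ => v₀ + t).tendsto t).mono_left
              nhdsWithin_le_nhds
          · filter_upwards [self_mem_nhdsWithin] with u hu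
            simpa using hu
        filter_upwards [h4.eventually (hγ.eventually_eq_flow hT (v₀ + t))] with s hs
        rw [hs]
        congr 1
        ring
      filter_upwards [h1, h2, h3, self_mem_nhdsWithin] with s h1 h2 h3 h4
      have h4' : t < s := h4
      rw [hD' _ (sub_nonneg.2 h4'.le)] at h2
      refine (hd.eq_zero_iff _ _).1 ?_
      rw [← hiso _ _ _ h1 h2, proj_liftFlow, hβp s (ht0.trans h4'.le), hβp t ht0, h3, dist_self]
  · intro u hu hc
    obtain ⟨h1, h2⟩ := hβd L u hu hc
    refine ⟨_, hβl u, ?_⟩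
    rw [hd.symm]
    refine hlink (γ (v₀ + u)) _ _ _ (fun w => ?_)
      (hlink' _ _ (hlt v₀ (v₀ + u) (by linarith)) (hσ0 u h1.le))
    obtain ⟨s, hs, hs'⟩ := hsegτ (v₀ + u) w
    have h3 := (hA s).2
    simp only [hs] at h3
    rw [hs']
    exact h3 h2
  · have hk : 0 ≤ l * k := mul_nonneg hγ.length_pos.le k.cast_nonneg
    -- The adjoint inherits from the time function that `k` time periods correspond to `k` parameter
    -- periods.
    have hσk : σ (v₀ + l * k) = s₀ + k := by
      have hle : ∀ s, s ≤ σ (v₀ + l * k) ↔ s ≤ s₀ + k := fun s => by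
        rw [← hσ, ← sub_le_iff_le_add, ← sub_le_iff_le_add, ← hσ v₀]
        have := hτp (s - k) k
        rw [Int.cast_natCast, sub_add_cancel] at this
        rw [this, add_sub_cancel_right]
      exact le_antisymm ((hle _).1 le_rfl) ((hle _).2 le_rfl)
    have e0 : β 0 = B (s₀ - s₀) := by simp only [β, add_zero]; rfl
    have ek : β (l * k) = B (s₀ + k - s₀) := by simp only [β, hσk]
    have h1 := hlink' s₀ (s₀ + k) le_rfl (by simp)
    rw [e0, ek]
    refine ⟨?_, ?_⟩
    · rw [h1.proj_left, h1.proj_right, seg_zero, seg_one]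
      exact_mod_cast hAp s₀ k
    · rw [h1.primitive_eq hK, curveValue_seg_nat c hAp, hAΓ]

variable [CompactSpace M] [LocallyPathConnectedSpace M] [ConnectedSpace M]

/-- A positive value on one periodic pseudo-orbit would accumulate over `k` turns of its lift and
exceed the bound `C`. -/
theorem IsQuasiLyapunov.exists_forall_periodic (hd : IsLiftedMetric d) {φ : Flow ℝ M} {T : ℝ}
    (hT : 0 < T) {c : Cocycles M} (hK : K ≤ intKer (Submodule.Quotient.mk c))
    (h : IsQuasiLyapunov φ T d (Submodule.Quotient.mk c)) :
    ∃ ε > 0, ∀ (l : ℝ) (γ : ℝ → M), IsPeriodicPseudoOrbit φ ε T l γ →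
      ∀ h, IsClassOf ε l γ h → eval ℝ (Submodule.Quotient.mk c) h ≤ 0 := by
  obtain ⟨f, hfc, hf⟩ := hd.exists_equivariant hK
  obtain ⟨C, hC, ε', hε', hQL⟩ := h f hfc hf
  obtain ⟨ε, hε, hlink⟩ := hd.exists_forall_link_lt hε'
  refine ⟨ε, hε, ?_⟩
  rintro l γ hγ _ ⟨Γ, hΓ, rfl⟩
  rw [eval_loopClass]
  obtain ⟨β, hβ, hval⟩ := hγ.exists_lift hd hT hK hlink (fun z => by
    obtain ⟨p, hp⟩ := PathSpace.exists_endpoint (x₀ := x₀) z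
    exact ⟨Cover.mk K p, hp⟩) hΓ
  have hl := hγ.length_pos
  by_contra! hpos
  obtain ⟨k, hk⟩ := exists_nat_gt (C / curveValue c Γ)
  rw [div_lt_iff₀ hpos] at hk
  have hlk : 0 ≤ l * k := mul_nonneg hl.le k.cast_nonneg
  -- The length exceeds `l * k` so that this time lies in the half-open domain.
  have h1 := hQL (l * k + 1) β (hβ _ (by linarith)) (l * k) ⟨hlk, by linarith⟩
  obtain ⟨h2, h3⟩ := hval k
  have h4 := (isEquivariant_iff hK).1 hf (β 0) (β (l * k)) h2.symm
  linarith

end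

end

/-! ### Dependence on the scale, directions, and conclusion -/

section

variable {M : Type*} [MetricSpace M]

theorem IsPeriodicPseudoOrbit.mono {φ : Flow ℝ M} {ε ε' T l : ℝ} {γ : ℝ → M}
    (h : IsPeriodicPseudoOrbit φ ε' T l γ) (hε : ε' ≤ ε) : IsPeriodicPseudoOrbit φ ε T l γ :=
  { h with
    jump := fun u hu => by
      obtain ⟨y, hy, hd⟩ := h.jump u hu
      exact ⟨y, hy, hd.trans_le hε⟩ }

theorem IsClassOf.mono {ε ε' l : ℝ} {γ : ℝ → M} {h : H1 ℝ M} (hh : IsClassOf ε' l γ h)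
    (hε : ε' ≤ ε) : IsClassOf ε l γ h := by
  obtain ⟨Γ, ⟨hc, τ, hm, hτ, hg⟩, rfl⟩ := hh
  exact ⟨Γ, ⟨hc, τ, hm, hτ, fun s =>
    ⟨(hg s).1, fun hs => Metric.ball_subset_ball hε ((hg s).2 hs)⟩⟩, rfl⟩

/-- Linear forms are continuous for the module topology, so the half-space is closed; dividing by a
positive length does not affect the sign. -/
theorem forall_pseudoDirections_iff (φ : Flow ℝ M) (ε T : ℝ) (α : Cohomology M) :
    (∀ v ∈ pseudoDirections φ ε T, eval ℝ α v ≤ 0) ↔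
      ∀ (l : ℝ) (γ : ℝ → M), IsPeriodicPseudoOrbit φ ε T l γ →
        ∀ h, IsClassOf ε l γ h → eval ℝ α h ≤ 0 := by
  let τ : TopologicalSpace (H1 ℝ M) := moduleTopology ℝ (H1 ℝ M)
  have : IsModuleTopology ℝ (H1 ℝ M) := ⟨rfl⟩
  constructor
  · intro H l γ hγ h hh
    have h1 := H (l⁻¹ • h) (subset_closure ⟨l, γ, h, hγ, hh, rfl⟩)
    rw [map_smul, smul_eq_mul] at h1
    exact nonpos_of_mul_nonpos_right h1 (inv_pos.2 hγ.length_pos)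
  · intro H
    have hc : Continuous (eval ℝ α) := IsModuleTopology.continuous_of_linearMap _
    refine closure_minimal ?_ (isClosed_le hc continuous_const)
    rintro _ ⟨l, γ, h, hγ, hh, rfl⟩
    change eval ℝ α (l⁻¹ • h) ≤ 0
    rw [map_smul, smul_eq_mul]
    exact mul_nonpos_of_nonneg_of_nonpos (inv_nonneg.2 hγ.length_pos.le) (H l γ hγ h hh)

end

end QuasiLyapunov

end

theorem lemma3 {E H M : Type*} [NormedAddCommGroup E] [NormedSpace ℝ E] [FiniteDimensional ℝ E]
    [TopologicalSpace H] (I : ModelWithCorners ℝ E H)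
    [MetricSpace M] [CompactSpace M] [ConnectedSpace M] [ChartedSpace H M]
    (φ : Flow ℝ M) (T : ℝ) (hT : 0 < T) (x₀ : M) (α : Cohomology M)
    (d : Cover x₀ (intKer α) → Cover x₀ (intKer α) → ℝ) (hd : IsLiftedMetric d)
    (d' : Cover x₀ (⊥ : Submodule ℤ (H1 ℤ M)) → Cover x₀ (⊥ : Submodule ℤ (H1 ℤ M)) → ℝ)
    (hd' : IsLiftedMetric d') :
    List.TFAE [
      IsQuasiLyapunov φ T d α,
      IsQuasiLyapunov φ T d' α,
      ∃ ε > 0, IsSmall M ε ∧ ∀ v ∈ pseudoDirections φ ε T, eval ℝ α v ≤ 0,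
      ∀ᶠ ε in 𝓝[>] (0 : ℝ), IsSmall M ε ∧ ∀ v ∈ pseudoDirections φ ε T, eval ℝ α v ≤ 0,
      ∃ ε > 0, IsSmall M ε ∧ ∀ (l : ℝ) (γ : ℝ → M), IsPeriodicPseudoOrbit φ ε T l γ →
        ∀ h, IsClassOf ε l γ h → eval ℝ α h ≤ 0,
      ∀ᶠ ε in 𝓝[>] (0 : ℝ), IsSmall M ε ∧
        ∀ (l : ℝ) (γ : ℝ → M), IsPeriodicPseudoOrbit φ ε T l γ →
          ∀ h, IsClassOf ε l γ h → eval ℝ α h ≤ 0] := by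
  have := locallyPathConnectedSpace_of_modelWithCorners I M
  obtain ⟨ε₀, hε₀, hsmall⟩ := exists_isSmall I M
  obtain ⟨c, rfl⟩ := Submodule.Quotient.mk_surjective _ α
  have hmono : ∀ ε > 0, (∀ (l : ℝ) (γ : ℝ → M), IsPeriodicPseudoOrbit φ ε T l γ →
      ∀ h, IsClassOf ε l γ h → eval ℝ (Submodule.Quotient.mk c) h ≤ 0) →
      ∀ᶠ ε in 𝓝[>] (0 : ℝ), IsSmall M ε ∧
        ∀ (l : ℝ) (γ : ℝ → M), IsPeriodicPseudoOrbit φ ε T l γ →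
          ∀ h, IsClassOf ε l γ h → eval ℝ (Submodule.Quotient.mk c) h ≤ 0 := by
    intro ε hε H
    filter_upwards [Ioo_mem_nhdsGT (lt_min hε hε₀)] with ε' hε'
    have h1 : ε' ≤ ε := hε'.2.le.trans (min_le_left _ _)
    exact ⟨hsmall.mono (hε'.2.le.trans (min_le_right _ _)), fun l γ hγ h hh =>
      H l γ (hγ.mono h1) h (hh.mono h1)⟩
  simp only [forall_pseudoDirections_iff]
  -- The two coverings differ only in the proof that `K` is in the integral kernel: `le_rfl` for the
  -- kernel itself, `bot_le` for the universal Abelian covering.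
  tfae_have 1 → 6 := fun H => by
    obtain ⟨ε, hε, h⟩ := H.exists_forall_periodic hd hT le_rfl
    exact hmono ε hε h
  tfae_have 2 → 6 := fun H => by
    obtain ⟨ε, hε, h⟩ := H.exists_forall_periodic hd' hT bot_le
    exact hmono ε hε h
  tfae_have 6 → 5 := fun H => by
    obtain ⟨ε, h, hε⟩ := (H.and self_mem_nhdsWithin).exists
    exact ⟨ε, hε, h⟩
  tfae_have 5 → 1 := fun ⟨ε, hε, _, h⟩ => isQuasiLyapunov_of_forall_periodic hd hε hT le_rfl h
  tfae_have 5 → 2 := fun ⟨ε, hε, _, h⟩ => isQuasiLyapunov_of_forall_periodic hd' hε hT bot_le h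
  tfae_have 3 ↔ 5 := Iff.rfl
  tfae_have 4 ↔ 6 := Iff.rfl
  tfae_finish
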